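/- **Setting.** Let $1\le S\le N$, $R\ge1$, $\lambda>0$, $\mu>0$, $\beta\ge1$, $\delta\ge0$. For $i=1,\dots,N$ let $\xi_i$ be a random data sample of client $i$, $\tilde f_i(w;\xi_i)$ a loss differentiable in $w\in\mathbb R^d$, and $f_i(w)=\mathbb E[\tilde f_i(w;\xi_i)]$. Assume that each $f_i$ is differentiable and $\mu$-strongly convex, and that $\mathbb E[\nabla\tilde f_i(w;\xi_i)]=\nabla f_i(w)$ and $\mathbb E\|\nabla\tilde f_i(w;\xi_i)-\nabla f_i(w)\|^2\le\gamma_f^2$ for all $i,w$. Let $$F_i(w)=\min_{\theta}\Big\{f_i(\theta)+\tfrac\lambda2\|\theta-w\|^2\Big\},\qquad \hat\theta_i(w)=\arg\min_\theta\Big\{f_i(\theta)+\tfrac\lambda2\|\theta-w\|^2\Big\},\qquad F=\frac1N\sum_{i=1}^NF_i,$$ $w^*=\arg\min F$, $\sigma_{F,1}^2=\frac1N\sum_i\|\nabla F_i(w^*)\|^2$, $L_F=\lambda$, $\mu_F=\frac{\lambda\mu}{\lambda+\mu}$, $\kappa_F=L_F/\mu_F$, $\hat\eta_1=\frac1{6L_F(3+128\kappa_F/\beta)}$.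 **Algorithm (pFedMe).** Start at a deterministic $w_0$. In round $t=0,\dots,T-1$ every client $i$ sets $w_{i,0}^t=w_t$ and, for $r=0,\dots,R-1$, draws a fresh mini-batch $\mathcal D$ of $|\mathcal D|\geq 1$ independent samples, finds $\tilde\theta_i(w_{i,r}^t)$ with $\|\nabla\tilde h_i(\tilde\theta_i(w_{i,r}^t))\|^2\le\nu$, where $\tilde h_i(\theta)=\frac1{|\mathcal D|}\sum_{\xi\in\mathcal D}\tilde f_i(\theta;\xi)+\frac\lambda2\|\theta-w_{i,r}^t\|^2$, and sets $w_{i,r+1}^t=w_{i,r}^t-\eta\lambda\big(w_{i,r}^t-\tilde\theta_i(w_{i,r}^t)\big)$. The server then draws a uniformly random set $\mathcal S^t$ of $S$ clients, independently of everything before, and sets $w_{t+1}=(1-\beta)w_t+\frac\beta S\sum_{i\in\mathcal S^t}w_{i,R}^t$. After the last round every client computes in the same way $\tilde\theta_i^T(w_T)$ at $w_T$. The computed personalized models are $\delta$-approximate in mean square: $\mathbb E\|\tilde\theta_i(w_{i,r}^t)-\hat\theta_i(w_{i,r}^t)\|^2\le\delta^2$ for all of these computations. (If every mini-batch objective $\tilde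 h_i$ is $m$-strongly convex for some $m>0$, this need not be required: it suffices that $\delta^2\ge\frac{2}{m^2}\big(\frac{\gamma_f^2}{|\mathcal D|}+\nu\big)$.) **Theorem.** There is a universal constant $C$ such that, whenever $T\ge\frac{2}{\hat\eta_1\mu_F}$, there exists a step size $0<\eta\le\frac{\hat\eta_1}{\beta R}$ for which every run of the algorithm satisfies $$\text{(a)}\quad \mathbb E\big[F(\bar w_T)-F(w^*)\big]\le C\,\mathcal E,\qquad \text{(b)}\quad \frac1N\sum_{i=1}^N\mathbb E\|\tilde\theta_i^T(w_T)-w^*\|^2\le\frac{C\,\mathcal E}{\mu_F}+C\Big(\frac{\sigma_{F,1}^2}{\lambda^2}+\delta^2\Big),$$ where $$\mathcal E=\Delta_0\mu_Fe^{-\hat\eta_1\mu_FT/2}+\Lambda E_2+\Lambda^2E_3+\frac{\lambda^2\delta^2}{\mu_F},\qquad E_2=\frac{(N/S-1)\sigma_{F,1}^2}{\mu_FTN},\qquad E_3=\frac{(R\sigma_{F,1}^2+\delta^2\lambda^2)\,\kappa_FL_F}{R\,(T\beta\mu_F)^2}.$$ Here $\Delta_0=\|w_0-w^*\|^2$; $\bar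 w_T=\frac{1}{A_T}\sum_{t=0}^{T-1}\alpha_tw_t$ with $\alpha_t=(1-\tilde\eta\mu_F/2)^{-(t+1)}$, $\tilde\eta=\eta\beta R$ and $A_T=\sum_{t=0}^{T-1}\alpha_t$; and $\Lambda=1+\max\big\{0,\ln\frac{\mu_F\Delta_0}{E_2+E_3}\big\}$ is a logarithmic factor ($\Lambda=1$ if $\Delta_0=0$ or $E_2+E_3=0$). -/

import Mathlib

open MeasureTheory ProbabilityTheory
open scoped BigOperators ENNReal

noncomputable section

namespace PFedMe

/-- The model space `ℝ^d` with its Euclidean norm. -/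
abbrev Model (d : ℕ) : Type := EuclideanSpace ℝ (Fin d)

/-- A differentiable `m`-strongly convex function, through the first-order inequality. -/
def StronglyConvex {d : ℕ} (m : ℝ) (g : Model d → ℝ) : Prop :=
  Differentiable ℝ g ∧
    ∀ w w' : Model d,
      g w' + inner ℝ (gradient g w') (w - w') + m / 2 * ‖w - w'‖ ^ 2 ≤ g w

/-- A global minimizer of `g` (an arbitrary point if there is none). -/
def argmin {d : ℕ} (g : Model d → ℝ) : Model d :=
  Classical.epsilon fun x => ∀ y, g x ≤ g y

/-- The Moreau envelope `w ↦ min_θ { f θ + lam/2 ‖θ - w‖² }`. -/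
def moreau {d : ℕ} (lam : ℝ) (f : Model d → ℝ) (w : Model d) : ℝ :=
  ⨅ θ : Model d, (f θ + lam / 2 * ‖θ - w‖ ^ 2)

/-- The proximal point `argmin_θ { f θ + lam/2 ‖θ - w‖² }`: the exact personalized model. -/
def prox {d : ℕ} (lam : ℝ) (f : Model d → ℝ) (w : Model d) : Model d :=
  argmin fun θ => f θ + lam / 2 * ‖θ - w‖ ^ 2

/-- The global objective `F = (1/N) ∑ F_i`, where `F_i` is the Moreau envelope of `f_i`. -/
def globalObj {d N : ℕ} (lam : ℝ) (f : Fin N → Model d → ℝ) (w : Model d) : ℝ :=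
  (1 / (N : ℝ)) * ∑ i, moreau lam (f i) w

/-- The minimizer `w*` of the global objective. -/
def wStar {d N : ℕ} (lam : ℝ) (f : Fin N → Model d → ℝ) : Model d :=
  argmin (globalObj lam f)

/-- `σ²_{F,1} = (1/N) ∑ ‖∇F_i(w*)‖²`. -/
def sigmaSq {d N : ℕ} (lam : ℝ) (f : Fin N → Model d → ℝ) : ℝ :=
  (1 / (N : ℝ)) * ∑ i, ‖gradient (moreau lam (f i)) (wStar lam f)‖ ^ 2

/-! Constants of the Moreau envelopes; the smoothness constant `L_F` is `lam`. -/

def muF (lam mu : ℝ) : ℝ := lam * mu / (lam + mu)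

def kappaF (lam mu : ℝ) : ℝ := lam / muF lam mu

/-- `η̂₁ = 1 / (6 L_F (3 + 128 κ_F / β))`. -/
def etaHat (lam mu beta : ℝ) : ℝ :=
  1 / (6 * lam * (3 + 128 * kappaF lam mu / beta))

/-! ### Stochastic losses -/

section Loss

variable {d N : ℕ} {Ξ : Fin N → Type*} [∀ i, MeasurableSpace (Ξ i)]

/-- `f_i(w) = 𝔼_ξ [ℓ_i(w; ξ)]`. -/
def expectedLoss (D : ∀ i, Measure (Ξ i)) (ℓ : ∀ i, Model d → Ξ i → ℝ) (i : Fin N)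
    (w : Model d) : ℝ :=
  ∫ ξ, ℓ i w ξ ∂(D i)

/-- The gradient in the model of the loss of one sample. -/
def sampleGrad (ℓ : ∀ i, Model d → Ξ i → ℝ) (i : Fin N) (w : Model d) (ξ : Ξ i) : Model d :=
  gradient (fun v => ℓ i v ξ) w

/-- Well-posedness of the stochastic losses: `f_i` is a genuine expectation and
stochastic gradients are unbiased estimates of `∇f_i`. -/
structure IsStochasticLoss (D : ∀ i, Measure (Ξ i)) (ℓ : ∀ i, Model d → Ξ i → ℝ) : Prop where
  integrable : ∀ i w, Integrable (ℓ i w) (D i)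
  differentiable : ∀ i ξ, Differentiable ℝ (fun w => ℓ i w ξ)
  measurable_grad : ∀ i, Measurable (fun p : Model d × Ξ i => sampleGrad ℓ i p.1 p.2)
  integrable_grad : ∀ i w, Integrable (sampleGrad ℓ i w) (D i)
  unbiased : ∀ i w, ∫ ξ, sampleGrad ℓ i w ξ ∂(D i) = gradient (expectedLoss D ℓ i) w

/-- Bounded variance of the stochastic gradients. -/
def BoundedVariance (D : ∀ i, Measure (Ξ i)) (ℓ : ∀ i, Model d → Ξ i → ℝ) (gam : ℝ) : Prop :=
  ∀ i w,
    Integrable (fun ξ => ‖sampleGrad ℓ i w ξ - gradient (expectedLoss D ℓ i) w‖ ^ 2) (D i) ∧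
      ∫ ξ, ‖sampleGrad ℓ i w ξ - gradient (expectedLoss D ℓ i) w‖ ^ 2 ∂(D i) ≤ gam ^ 2

/-- The mini-batch objective
`h̃_i(θ; w, batch) = (1/B) ∑ ℓ_i(θ; ξ_k) + lam/2 ‖θ - w‖²`. -/
def batchObj (ℓ : ∀ i, Model d → Ξ i → ℝ) (lam : ℝ) {B : ℕ} (i : Fin N) (w : Model d)
    (batch : Fin B → Ξ i) (θ : Model d) : ℝ :=
  (1 / (B : ℝ)) * ∑ k, ℓ i θ (batch k) + lam / 2 * ‖θ - w‖ ^ 2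

end Loss

/-! ### The algorithm -/

/-- Local updates of one client in one round, started at `w`; `θ r` is the approximate
personalized model used in local step `r`:
`w_{r+1} = w_r - η lam (w_r - θ r)`. -/
def localModel {d : ℕ} (lam eta : ℝ) (θ : ℕ → Model d) (w : Model d) : ℕ → Model d
  | 0 => w
  | r + 1 => localModel lam eta θ w r - (eta * lam) • (localModel lam eta θ w r - θ r)

/-- The global models
`w_{t+1} = (1 - β) w_t + (β/S) ∑_{i ∈ 𝒮_t} w_{i,R}^t`; `θ t i r` is the approximate
personalized model of client `i` in local step `r` of round `t`. -/
def globalModel {d N : ℕ} (R S : ℕ) (lam beta eta : ℝ) (w0 : Model d)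
    (θ : ℕ → Fin N → ℕ → Model d) (sel : ℕ → Finset (Fin N)) : ℕ → Model d
  | 0 => w0
  | t + 1 =>
      (1 - beta) • globalModel R S lam beta eta w0 θ sel t +
        (beta / (S : ℝ)) •
          ∑ i ∈ sel t, localModel lam eta (θ t i) (globalModel R S lam beta eta w0 θ sel t) R

/-- The pairs `(t, r)` at which clients solve inner problems: `R` local steps in each of the
rounds `0, …, T-1`, and once more at the final global model `w_T`. -/
def Active (T R t r : ℕ) : Prop := (t < T ∧ r < R) ∨ (t = T ∧ r = 0)

/-- A run of the algorithm on a probability space: `T` global rounds, `R` local steps, `S`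
sampled clients per round, mini-batches of size `B`, step size `eta`, accuracy level `nu`.
`hist t r` is what is known before the mini-batches of local step `r` of round `t` are drawn. -/
structure Run {d N : ℕ} {Ξ : Fin N → Type*} [∀ i, MeasurableSpace (Ξ i)]
    (D : ∀ i, Measure (Ξ i)) (ℓ : ∀ i, Model d → Ξ i → ℝ) (T R S B : ℕ)
    (lam beta eta nu : ℝ) (w0 : Model d)
    {Ω : Type*} [MeasurableSpace Ω] (P : Measure Ω) where
  /-- the mini-batches -/
  batch : ℕ → (i : Fin N) → ℕ → Ω → (Fin B → Ξ i)
  /-- the approximate personalized models -/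
  theta : ℕ → Fin N → ℕ → Ω → Model d
  /-- the sampled sets of clients -/
  sel : ℕ → Ω → Finset (Fin N)
  hist : ℕ → ℕ → MeasurableSpace Ω
  hist_le : ∀ t r, hist t r ≤ ‹MeasurableSpace Ω›
  hist_local : ∀ t r, hist t r ≤ hist t (r + 1)
  hist_global : ∀ t, hist t R ≤ hist (t + 1) 0
  batch_measurable : ∀ t i r, Active T R t r → Measurable[hist t (r + 1)] (batch t i r)
  /-- each mini-batch consists of `B` independent samples of the client's distribution … -/
  batch_law : ∀ t i r, Active T R t r → P.map (batch t i r) = Measure.pi fun _ => D i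
  /-- … and is fresh -/
  batch_fresh : ∀ t i r, Active T R t r →
    Indep (MeasurableSpace.comap (batch t i r) inferInstance) (hist t r) P
  theta_measurable : ∀ t i r, Active T R t r → Measurable[hist t (r + 1)] (theta t i r)
  /-- the mini-batch objective is minimized up to accuracy level `nu` -/
  theta_accuracy : ∀ t i r, Active T R t r → ∀ ω,
    ‖gradient
        (batchObj ℓ lam i
          (localModel lam eta (fun k => theta t i k ω)
            (globalModel R S lam beta eta w0 (fun t' j k => theta t' j k ω)
              (fun t' => sel t' ω) t) r)
          (batch t i r ω))
        (theta t i r ω)‖ ^ 2 ≤ nu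
  sel_measurable : ∀ t, t < T → Measurable[hist (t + 1) 0, ⊤] (sel t)
  /-- the sampled clients form a uniformly random set of size `S` … -/
  sel_uniform : ∀ t, t < T → ∀ s : Finset (Fin N), s.card = S →
    P {ω | sel t ω = s} = ((N.choose S : ℕ) : ℝ≥0∞)⁻¹
  /-- … independent of all that happened before, the local updates of the round included -/
  sel_indep : ∀ t, t < T → Indep (MeasurableSpace.comap (sel t) ⊤) (hist t R) P

namespace Run

variable {d N : ℕ} {Ξ : Fin N → Type*} [∀ i, MeasurableSpace (Ξ i)]
  {D : ∀ i, Measure (Ξ i)} {ℓ : ∀ i, Model d → Ξ i → ℝ} {T R S B : ℕ}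
  {lam beta eta nu : ℝ} {w0 : Model d} {Ω : Type*} [MeasurableSpace Ω] {P : Measure Ω}

/-- The global model `w_t`. -/
def w (run : Run D ℓ T R S B lam beta eta nu w0 P) (t : ℕ) (ω : Ω) : Model d :=
  globalModel R S lam beta eta w0 (fun t' j k => run.theta t' j k ω) (fun t' => run.sel t' ω) t

/-- The local model `w_{i,r}^t`. -/
def wLoc (run : Run D ℓ T R S B lam beta eta nu w0 P) (t : ℕ) (i : Fin N) (r : ℕ) (ω : Ω) :
    Model d :=
  localModel lam eta (fun k => run.theta t i k ω) (run.w t ω) r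

/-- Every computed personalized model is, in mean square, a `δ`-approximation of the exact
personalized model. -/
def IsDeltaApprox (run : Run D ℓ T R S B lam beta eta nu w0 P) (delta : ℝ) : Prop :=
  ∀ t i r, Active T R t r →
    Integrable
        (fun ω => ‖run.theta t i r ω - prox lam (expectedLoss D ℓ i) (run.wLoc t i r ω)‖ ^ 2) P ∧
      ∫ ω, ‖run.theta t i r ω - prox lam (expectedLoss D ℓ i) (run.wLoc t i r ω)‖ ^ 2 ∂P
        ≤ delta ^ 2

/-- The weights `α_t = (1 - η̃ μ_F / 2)^{-(t+1)}`, with the effective global step size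
`η̃ = η β R`. -/
def weight (R : ℕ) (beta eta muF : ℝ) (t : ℕ) : ℝ :=
  ((1 - eta * beta * (R : ℝ) * muF / 2) ^ (t + 1))⁻¹

/-- The weighted average `∑_{t<T} α_t w_t / A_T`. -/
def wBar (run : Run D ℓ T R S B lam beta eta nu w0 P) (muF : ℝ) (ω : Ω) : Model d :=
  (∑ t ∈ Finset.range T, weight R beta eta muF t)⁻¹ •
    ∑ t ∈ Finset.range T, weight R beta eta muF t • run.w t ω

end Run

/-! ### The error terms -/

/-- `(N/S - 1) σ² / (μ_F T N)`. -/
def samplingErr (N S T : ℕ) (muF sig2 : ℝ) : ℝ :=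
  ((N : ℝ) / S - 1) * sig2 / (muF * T * N)

/-- `(R σ² + δ² lam²) κ_F L_F / (R (T β μ_F)²)`, with `L_F = lam` and `κ_F = lam / μ_F`. -/
def driftErr (R T : ℕ) (lam beta muF sig2 delta : ℝ) : ℝ :=
  ((R : ℝ) * sig2 + delta ^ 2 * lam ^ 2) * (lam / muF) * lam / (R * (T * beta * muF) ^ 2)

/-- The logarithmic factor `1 + log⁺ (μ_F Δ₀ / noise)`. -/
def logFactor (muF delta0 noise : ℝ) : ℝ := 1 + max 0 (Real.log (muF * delta0 / noise))

/-- The sum of the four error terms for the global model. -/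
def errorBound (N S R T : ℕ) (lam mu beta sig2 delta delta0 : ℝ) : ℝ :=
  let m := muF lam mu
  let samp := samplingErr N S T m sig2
  let drift := driftErr R T lam beta m sig2 delta
  let Λ := logFactor m delta0 (samp + drift)
  delta0 * m * Real.exp (-(etaHat lam mu beta * m * T) / 2) + Λ * samp + Λ ^ 2 * drift +
    lam ^ 2 * delta ^ 2 / m

end PFedMe

end

/-! Since `∇F_i(w) = lam • (w - prox w)`, a local step of pFedMe is a gradient step on the Moreau
envelope `F_i`, up to the error of the computed personalized model. All that is needed about
envelopes follows from two bounds on their Bregman divergence, `le_moreau_bregman` and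
`moreau_bregman_le`: differentiability, `lam`-smoothness, co-coercivity and `muF`-strong convexity.
A whole round is then one inexact stochastic gradient step on `F` of effective length `τ = η β R`
(`nextModel_eq`). Three errors spoil it: the drift of the local models during the round and the
inaccuracy of the personalized models (both in `norm_localDir_sub_sq_le`), and the sampling of `S`
clients without replacement (`subsetMean_norm_sq`).

For fixed personalized models, averaging over the sampled set shows that the squared distance to
`w*` contracts by `1 - τ μ_F / 2`, with an extra decrease `τ / 2 * (F - F*)`, up to noise of order
`τ²` (sampling), `τ³` (drift) and `τ` (inaccuracy): this is `subsetMean_round_le`. Sampling is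
independent of the local updates, so the inequality passes to expectations (`integral_round_le`).

Telescoping with the weights `α_t` bounds the weighted average of the gaps and `μ_F` times the last
squared distance by one and the same quantity (`weighted_bounds`). It contains an exponential
decreasing in `τ` and noise increasing in `τ`. Taking `τ` as the smaller of `η̂₁` and `2 Λ / (μ_F
T)` balances them, at the price of logarithmic factors (`exists_step_size`). Jensen's inequality
gives (a). For (b), the last distance is combined with the distance from a global model to its
proximal points (`integral_theta_final_le`).

The alternative accuracy hypothesis is reduced to the mean-square one in
`isDeltaApprox_of_stronglyConvex`: at the exact proximal point the mini-batch gradient is pure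
sampling noise, of mean square at most `γ² / B`. -/

noncomputable section

namespace PFedMe

/-! ### Strongly convex functions, proximal points and Moreau envelopes. -/

section Convex

variable {d : ℕ}

theorem hasGradientAt_add {f g : Model d → ℝ} {f' g' x : Model d} (hf : HasGradientAt f f' x)
    (hg : HasGradientAt g g' x) : HasGradientAt (fun y => f y + g y) (f' + g') x := by
  rw [hasGradientAt_iff_hasFDerivAt] at *
  rw [map_add]
  exact hf.add hg

theorem hasGradientAt_const_mul {f : Model d → ℝ} {f' x : Model d} (c : ℝ)
    (hf : HasGradientAt f f' x) : HasGradientAt (fun y => c * f y) (c • f') x := by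
  rw [hasGradientAt_iff_hasFDerivAt] at *
  rw [map_smul]
  exact hf.const_mul c

theorem hasGradientAt_sum {ι : Type*} (s : Finset ι) {f : ι → Model d → ℝ} {f' : ι → Model d}
    {x : Model d} (hf : ∀ i ∈ s, HasGradientAt (f i) (f' i) x) :
    HasGradientAt (fun y => ∑ i ∈ s, f i y) (∑ i ∈ s, f' i) x := by
  simp only [hasGradientAt_iff_hasFDerivAt] at *
  rw [map_sum]
  exact HasFDerivAt.fun_sum hf

/-- A quadratically accurate first-order expansion identifies the gradient. -/
theorem hasGradientAt_of_quadratic {F : Model d → ℝ} {G x : Model d} (c : ℝ)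
    (h : ∀ y, |F y - F x - inner ℝ G (y - x)| ≤ c * ‖y - x‖ ^ 2) : HasGradientAt F G x := by
  rw [hasGradientAt_iff_isLittleO]
  have h1 : (fun y => F y - F x - inner ℝ G (y - x)) =O[nhds x] fun y => ‖y - x‖ ^ 2 := by
    refine Asymptotics.IsBigO.of_bound c (Filter.Eventually.of_forall fun y => ?_)
    rw [Real.norm_eq_abs, Real.norm_of_nonneg (by positivity)]
    exact h y
  refine h1.trans_isLittleO ?_
  exact Asymptotics.isLittleO_pow_sub_sub x one_lt_two

theorem hasGradientAt_sq_dist (lam : ℝ) (w x : Model d) :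
    HasGradientAt (fun θ => lam / 2 * ‖θ - w‖ ^ 2) (lam • (x - w)) x := by
  refine hasGradientAt_of_quadratic |lam / 2| fun y => le_of_eq ?_
  have : y - w = (y - x) + (x - w) := by abel
  rw [this, norm_add_sq_real, inner_smul_left, real_inner_comm]
  simp only [conj_trivial]
  rw [show lam / 2 * (‖y - x‖ ^ 2 + 2 * inner ℝ (x - w) (y - x) + ‖x - w‖ ^ 2)
      - lam / 2 * ‖x - w‖ ^ 2 - lam * inner ℝ (x - w) (y - x) = lam / 2 * ‖y - x‖ ^ 2 by ring,
    abs_mul, abs_of_nonneg (sq_nonneg ‖y - x‖)]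

theorem gradient_eq_zero_of_forall_le {g : Model d → ℝ} {x : Model d} (h : ∀ y, g x ≤ g y) :
    gradient g x = 0 := by
  have : IsLocalMin g x := Filter.Eventually.of_forall h
  simp [gradient, this.fderiv_eq_zero]

theorem StronglyConvex.exists_forall_le {m : ℝ} {g : Model d → ℝ} (hm : 0 < m)
    (h : StronglyConvex m g) : ∃ x, ∀ y, g x ≤ g y := by
  refine h.1.continuous.exists_forall_le' 0 ?_
  -- Beyond this radius the quadratic term of the lower bound at `0` outweighs the linear one.
  filter_upwards [(tendsto_norm_cocompact_atTop (E := Model d)).eventually_ge_atTop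
    (2 * ‖gradient g 0‖ / m)] with w hw
  have h1 := h.2 w 0
  have h2 := neg_le_of_abs_le (abs_real_inner_le_norm (gradient g 0) w)
  rw [div_le_iff₀ hm] at hw
  rw [sub_zero] at h1
  nlinarith [norm_nonneg w]

theorem StronglyConvex.argmin_le {m : ℝ} {g : Model d → ℝ} (hm : 0 < m)
    (h : StronglyConvex m g) (y : Model d) : g (argmin g) ≤ g y :=
  Classical.epsilon_spec (h.exists_forall_le hm) y

theorem StronglyConvex.mul_sq_le_inner {m : ℝ} {g : Model d → ℝ} (h : StronglyConvex m g)
    (x y : Model d) : m * ‖x - y‖ ^ 2 ≤ inner ℝ (gradient g x - gradient g y) (x - y) := by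
  have h1 := h.2 x y
  have h2 := h.2 y x
  rw [← neg_sub x y, inner_neg_right, norm_neg] at h2
  rw [inner_sub_left]
  linarith

/-- Converts gradient accuracy into distance: applied to mini-batch objectives, it compares the
computed model with the exact proximal point. -/
theorem StronglyConvex.mul_norm_le {m : ℝ} {g : Model d → ℝ} (h : StronglyConvex m g)
    (x y : Model d) : m * ‖x - y‖ ≤ ‖gradient g x - gradient g y‖ := by
  have h1 := h.mul_sq_le_inner x y
  have h2 := real_inner_le_norm (gradient g x - gradient g y) (x - y)
  rcases (norm_nonneg (x - y)).eq_or_lt with h0 | h0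
  · rw [← h0, mul_zero]; exact norm_nonneg _
  · nlinarith

/-- The modulus is really `mu + lam`; `mu` suffices here, since the lemma only serves to make `prox`
a true minimizer. -/
theorem StronglyConvex.add_sq_dist {mu lam : ℝ} {f : Model d → ℝ} (hlam : 0 ≤ lam)
    (hf : StronglyConvex mu f) (w : Model d) :
    StronglyConvex mu fun θ => f θ + lam / 2 * ‖θ - w‖ ^ 2 := by
  have hg : ∀ x, HasGradientAt (fun θ => f θ + lam / 2 * ‖θ - w‖ ^ 2)
      (gradient f x + lam • (x - w)) x := fun x =>
    hasGradientAt_add (hf.1 x).hasGradientAt (hasGradientAt_sq_dist lam w x)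
  refine ⟨fun x => (hg x).differentiableAt, fun x y => ?_⟩
  rw [(hg y).gradient, inner_add_left, inner_smul_left]
  have h1 := hf.2 x y
  have h2 : x - w = (x - y) + (y - w) := by abel
  have h3 : ‖x - w‖ ^ 2 = ‖x - y‖ ^ 2 + 2 * inner ℝ (y - w) (x - y) + ‖y - w‖ ^ 2 := by
    rw [h2, norm_add_sq_real, real_inner_comm (y - w)]
  simp only [conj_trivial, h3]
  nlinarith [mul_nonneg hlam (sq_nonneg ‖x - y‖)]

/-- The gradient of the Moreau envelope, in terms of the proximal point. -/
def moreauGrad (lam : ℝ) (f : Model d → ℝ) (w : Model d) : Model d :=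
  lam • (w - prox lam f w)

variable {mu lam : ℝ} {f : Model d → ℝ}

theorem prox_le (hlam : 0 ≤ lam) (hmu : 0 < mu) (hf : StronglyConvex mu f) (w θ : Model d) :
    f (prox lam f w) + lam / 2 * ‖prox lam f w - w‖ ^ 2 ≤ f θ + lam / 2 * ‖θ - w‖ ^ 2 :=
  (hf.add_sq_dist hlam w).argmin_le hmu θ

theorem gradient_prox (hlam : 0 ≤ lam) (hmu : 0 < mu) (hf : StronglyConvex mu f) (w : Model d) :
    gradient f (prox lam f w) = moreauGrad lam f w := by
  have h := gradient_eq_zero_of_forall_le (g := fun θ => f θ + lam / 2 * ‖θ - w‖ ^ 2)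
    (prox_le hlam hmu hf w)
  rw [(hasGradientAt_add (hf.1 _).hasGradientAt (hasGradientAt_sq_dist lam w _)).gradient] at h
  rw [eq_neg_of_add_eq_zero_left h, moreauGrad, ← smul_neg, neg_sub]

theorem moreau_eq (hlam : 0 ≤ lam) (hmu : 0 < mu) (hf : StronglyConvex mu f) (w : Model d) :
    moreau lam f w = f (prox lam f w) + lam / 2 * ‖prox lam f w - w‖ ^ 2 := by
  refine le_antisymm (ciInf_le ⟨f (prox lam f w) + lam / 2 * ‖prox lam f w - w‖ ^ 2, ?_⟩ _)
    (le_ciInf (prox_le hlam hmu hf w))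
  rintro _ ⟨θ, rfl⟩
  exact prox_le hlam hmu hf w θ

theorem moreau_le (hlam : 0 ≤ lam) (hmu : 0 < mu) (hf : StronglyConvex mu f) (w θ : Model d) :
    moreau lam f w ≤ f θ + lam / 2 * ‖θ - w‖ ^ 2 :=
  (moreau_eq hlam hmu hf w).trans_le (prox_le hlam hmu hf w θ)

/-- As `∇f(prox x) = lam • (x - prox x)`, monotonicity of `∇f` gives firm nonexpansiveness, `‖p -
q‖² ≤ ⟪x - y, p - q⟫`, and Cauchy–Schwarz concludes. -/
theorem norm_prox_sub_le (hlam : 0 < lam) (hmu : 0 < mu) (hf : StronglyConvex mu f)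
    (x y : Model d) : ‖prox lam f x - prox lam f y‖ ≤ ‖x - y‖ := by
  have h1 := hf.mul_sq_le_inner (prox lam f x) (prox lam f y)
  rw [gradient_prox hlam.le hmu hf, gradient_prox hlam.le hmu hf, moreauGrad, moreauGrad,
    ← smul_sub, inner_smul_left, conj_trivial] at h1
  set p := prox lam f x
  set q := prox lam f y
  have h2 : x - p - (y - q) = (x - y) - (p - q) := by abel
  rw [h2, inner_sub_left, real_inner_self_eq_norm_sq] at h1
  have h3 := real_inner_le_norm (x - y) (p - q)
  have h4 : 0 ≤ inner ℝ (x - y) (p - q) - ‖p - q‖ ^ 2 := by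
    by_contra hc
    push Not at hc
    nlinarith [sq_nonneg ‖p - q‖]
  rcases (norm_nonneg (p - q)).eq_or_lt with h0 | h0
  · rw [← h0]; exact norm_nonneg _
  · nlinarith

theorem continuous_prox (hlam : 0 < lam) (hmu : 0 < mu) (hf : StronglyConvex mu f) :
    Continuous (prox lam f) :=
  (LipschitzWith.of_dist_le_mul (K := 1) fun x y => by
    simpa [dist_eq_norm] using norm_prox_sub_le hlam hmu hf x y).continuous

/-- Bregman divergences of the Moreau envelope, bounded below. -/
theorem le_moreau_bregman (hlam : 0 < lam) (hmu : 0 < mu) (hf : StronglyConvex mu f)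
    (x y : Model d) :
    mu / 2 * ‖prox lam f x - prox lam f y‖ ^ 2
        + 1 / (2 * lam) * ‖moreauGrad lam f x - moreauGrad lam f y‖ ^ 2
      ≤ moreau lam f x - moreau lam f y - inner ℝ (moreauGrad lam f y) (x - y) := by
  rw [moreau_eq hlam.le hmu hf, moreau_eq hlam.le hmu hf]
  -- Strong convexity of `f` between the two proximal points is the only inequality used; what
  -- remains is an exact quadratic identity in `u = x - prox x` and `v = y - prox y`.
  have h1 := hf.2 (prox lam f x) (prox lam f y)
  rw [gradient_prox hlam.le hmu hf] at h1
  simp only [moreauGrad] at *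
  generalize prox lam f x = p at *
  generalize prox lam f y = q at *
  obtain ⟨u, rfl⟩ : ∃ u, x = p + u := ⟨x - p, by abel⟩
  obtain ⟨v, rfl⟩ : ∃ v, y = q + v := ⟨y - q, by abel⟩
  have e1 : p + u - p = u := by abel
  have e2 : q + v - q = v := by abel
  have e3 : p - (p + u) = -u := by abel
  have e4 : q - (q + v) = -v := by abel
  have e5 : p + u - (q + v) = (p - q) + (u - v) := by abel
  rw [e2] at h1
  rw [e1, e2, inner_smul_left, conj_trivial]
  rw [inner_smul_left, conj_trivial] at h1
  have e6 : inner ℝ v (u - v) = inner ℝ u v - ‖v‖ ^ 2 := by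
    rw [inner_sub_right, real_inner_self_eq_norm_sq, real_inner_comm]
  have e7 : 1 / (2 * lam) * ‖lam • u - lam • v‖ ^ 2
      = lam / 2 * (‖u‖ ^ 2 - 2 * inner ℝ u v + ‖v‖ ^ 2) := by
    rw [← smul_sub, norm_smul, mul_pow, Real.norm_eq_abs, sq_abs, norm_sub_sq_real]
    field_simp
  rw [e3, e4, e5, norm_neg, norm_neg, inner_add_right, e6, e7]
  linarith

theorem moreau_bregman_le (hlam : 0 < lam) (hmu : 0 < mu) (hf : StronglyConvex mu f)
    (x y : Model d) :
    moreau lam f x - moreau lam f y - inner ℝ (moreauGrad lam f y) (x - y)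
      ≤ lam / 2 * ‖x - y‖ ^ 2 := by
  -- The proximal point of `y` is a competitor in the infimum that defines the envelope at `x`.
  have h1 := moreau_le hlam.le hmu hf x (prox lam f y)
  rw [moreau_eq hlam.le hmu hf y, moreauGrad, inner_smul_left, conj_trivial]
  have e : prox lam f y - x = -((x - y) + (y - prox lam f y)) := by abel
  rw [e, norm_neg, norm_add_sq_real, real_inner_comm] at h1
  rw [norm_sub_rev (prox lam f y) y]
  linarith

/-- The two Bregman bounds squeeze the first-order remainder between `0` and a quadratic. -/
theorem hasGradientAt_moreau (hlam : 0 < lam) (hmu : 0 < mu) (hf : StronglyConvex mu f)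
    (y : Model d) : HasGradientAt (moreau lam f) (moreauGrad lam f y) y := by
  refine hasGradientAt_of_quadratic (lam / 2) fun x => ?_
  have h1 := le_moreau_bregman hlam hmu hf x y
  have h2 := moreau_bregman_le hlam hmu hf x y
  rw [abs_of_nonneg (le_trans (by positivity) h1)]
  exact h2

theorem muF_pos (hlam : 0 < lam) (hmu : 0 < mu) : 0 < muF lam mu := by
  unfold muF; positivity

theorem muF_le (hlam : 0 < lam) (hmu : 0 < mu) : muF lam mu ≤ lam := by
  unfold muF
  rw [div_le_iff₀ (by positivity)]
  nlinarith

theorem muF_le_moreau_bregman (hlam : 0 < lam) (hmu : 0 < mu) (hf : StronglyConvex mu f)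
    (x y : Model d) :
    muF lam mu / 2 * ‖x - y‖ ^ 2
      ≤ moreau lam f x - moreau lam f y - inner ℝ (moreauGrad lam f y) (x - y) := by
  refine le_trans ?_ (le_moreau_bregman hlam hmu hf x y)
  simp only [moreauGrad]
  rw [← smul_sub, norm_smul, mul_pow, Real.norm_eq_abs, sq_abs]
  set p := prox lam f x
  set q := prox lam f y
  have e : x - y = (p - q) + (x - p - (y - q)) := by abel
  have h1 : ‖x - y‖ ≤ ‖p - q‖ + ‖x - p - (y - q)‖ := by rw [e]; exact norm_add_le _ _
  generalize ‖p - q‖ = a at *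
  generalize ‖x - p - (y - q)‖ = b at *
  have h2 : ‖x - y‖ ^ 2 ≤ (a + b) ^ 2 := pow_le_pow_left₀ (norm_nonneg _) h1 2
  -- `muF` is the best constant here: after multiplication by `2 (lam + mu)` the two sides differ by
  -- the square `(mu a - lam b)²`.
  have h3 : muF lam mu / 2 * (a + b) ^ 2 ≤ mu / 2 * a ^ 2 + lam / 2 * b ^ 2 := by
    unfold muF
    rw [div_div, div_mul_eq_mul_div, div_le_iff₀ (by positivity)]
    nlinarith [sq_nonneg (mu * a - lam * b)]
  have h4 : 1 / (2 * lam) * (lam ^ 2 * b ^ 2) = lam / 2 * b ^ 2 := by field_simp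
  rw [h4]
  exact (mul_le_mul_of_nonneg_left h2 (by have := muF_pos hlam hmu; positivity)).trans h3

theorem norm_moreauGrad_sub_sq_le (hlam : 0 < lam) (hmu : 0 < mu) (hf : StronglyConvex mu f)
    (x y : Model d) :
    ‖moreauGrad lam f x - moreauGrad lam f y‖ ^ 2
      ≤ 2 * lam * (moreau lam f x - moreau lam f y - inner ℝ (moreauGrad lam f y) (x - y)) := by
  have h1 := le_moreau_bregman hlam hmu hf x y
  have h2 : 1 / (2 * lam) * ‖moreauGrad lam f x - moreauGrad lam f y‖ ^ 2
      ≤ moreau lam f x - moreau lam f y - inner ℝ (moreauGrad lam f y) (x - y) :=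
    le_trans (le_add_of_nonneg_left (by positivity)) h1
  rw [one_div, inv_mul_le_iff₀ (by positivity)] at h2
  exact h2

theorem norm_moreauGrad_sub_le (hlam : 0 < lam) (hmu : 0 < mu) (hf : StronglyConvex mu f)
    (x y : Model d) : ‖moreauGrad lam f x - moreauGrad lam f y‖ ≤ lam * ‖x - y‖ := by
  have h1 := norm_moreauGrad_sub_sq_le hlam hmu hf x y
  have h2 := moreau_bregman_le hlam hmu hf x y
  refine abs_le_of_sq_le_sq' ?_ (by positivity) |>.2
  nlinarith

/-- The Lipschitz constant of the inexact gradient step `x ↦ x - eta * lam * (x - prox x)`. -/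
theorem norm_prox_step_sub_le (hlam : 0 < lam) (hmu : 0 < mu) (hf : StronglyConvex mu f) {eta : ℝ}
    (h0 : 0 ≤ eta * lam) (h1 : eta * lam ≤ 1) (x y : Model d) :
    ‖(x - eta • moreauGrad lam f x) - (y - eta • moreauGrad lam f y)‖ ≤ ‖x - y‖ := by
  have h := norm_prox_sub_le hlam hmu hf x y
  -- The step is a convex combination of the identity and `prox`, both nonexpansive.
  have e : (x - eta • moreauGrad lam f x) - (y - eta • moreauGrad lam f y)
      = (1 - eta * lam) • (x - y) + (eta * lam) • (prox lam f x - prox lam f y) := by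
    simp only [moreauGrad]; module
  rw [e]
  refine (norm_add_le _ _).trans ?_
  rw [norm_smul, norm_smul, Real.norm_of_nonneg h0, Real.norm_of_nonneg (sub_nonneg.2 h1)]
  nlinarith

end Convex

/-! ### The global objective: convexity, smoothness and gradient bounds. -/

section Global

variable {d N : ℕ} {mu lam : ℝ} {f : Fin N → Model d → ℝ}

/-- The gradient of the global objective. -/
def globalGrad (lam : ℝ) (f : Fin N → Model d → ℝ) (w : Model d) : Model d :=
  (1 / (N : ℝ)) • ∑ i, moreauGrad lam (f i) w

theorem hasGradientAt_globalObj (hlam : 0 < lam) (hmu : 0 < mu)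
    (hf : ∀ i, StronglyConvex mu (f i)) (w : Model d) :
    HasGradientAt (globalObj lam f) (globalGrad lam f w) w :=
  hasGradientAt_const_mul _ (hasGradientAt_sum _ fun i _ => hasGradientAt_moreau hlam hmu (hf i) w)

theorem globalObj_bregman (lam : ℝ) (f : Fin N → Model d → ℝ) (x y : Model d) :
    globalObj lam f x - globalObj lam f y - inner ℝ (globalGrad lam f y) (x - y)
      = (1 / (N : ℝ)) * ∑ i, (moreau lam (f i) x - moreau lam (f i) y
          - inner ℝ (moreauGrad lam (f i) y) (x - y)) := by
  simp only [globalObj, globalGrad, inner_smul_left, sum_inner, conj_trivial,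
    Finset.sum_sub_distrib]
  ring

theorem stronglyConvex_globalObj (hN : 0 < N) (hlam : 0 < lam) (hmu : 0 < mu)
    (hf : ∀ i, StronglyConvex mu (f i)) : StronglyConvex (muF lam mu) (globalObj lam f) := by
  refine ⟨fun x => (hasGradientAt_globalObj hlam hmu hf x).differentiableAt, fun x y => ?_⟩
  rw [(hasGradientAt_globalObj hlam hmu hf y).gradient]
  have h1 : muF lam mu / 2 * ‖x - y‖ ^ 2 ≤ globalObj lam f x - globalObj lam f y
      - inner ℝ (globalGrad lam f y) (x - y) := by
    rw [globalObj_bregman]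
    have : (N : ℝ) ≠ 0 := by positivity
    calc muF lam mu / 2 * ‖x - y‖ ^ 2
        = (1 / (N : ℝ)) * ∑ _i : Fin N, muF lam mu / 2 * ‖x - y‖ ^ 2 := by
          simp; field_simp
      _ ≤ _ := by
          refine mul_le_mul_of_nonneg_left (Finset.sum_le_sum fun i _ => ?_) (by positivity)
          exact muF_le_moreau_bregman hlam hmu (hf i) x y
  linarith

theorem globalObj_wStar_le (hN : 0 < N) (hlam : 0 < lam) (hmu : 0 < mu)
    (hf : ∀ i, StronglyConvex mu (f i)) (w : Model d) :
    globalObj lam f (wStar lam f) ≤ globalObj lam f w :=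
  (stronglyConvex_globalObj hN hlam hmu hf).argmin_le (muF_pos hlam hmu) w

theorem globalGrad_wStar (hN : 0 < N) (hlam : 0 < lam) (hmu : 0 < mu)
    (hf : ∀ i, StronglyConvex mu (f i)) : globalGrad lam f (wStar lam f) = 0 := by
  rw [← (hasGradientAt_globalObj hlam hmu hf _).gradient]
  exact gradient_eq_zero_of_forall_le (globalObj_wStar_le hN hlam hmu hf)

theorem sigmaSq_eq (hlam : 0 < lam) (hmu : 0 < mu) (hf : ∀ i, StronglyConvex mu (f i)) :
    sigmaSq lam f = (1 / (N : ℝ)) * ∑ i, ‖moreauGrad lam (f i) (wStar lam f)‖ ^ 2 := by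
  simp only [sigmaSq, fun i => (hasGradientAt_moreau hlam hmu (hf i) (wStar lam f)).gradient]

theorem sigmaSq_nonneg (lam : ℝ) (f : Fin N → Model d → ℝ) : 0 ≤ sigmaSq lam f := by
  unfold sigmaSq; positivity

/-- Client gradients have mean square at most `4 L_F (F - F*) + 2 σ²`. -/
theorem mean_norm_moreauGrad_sq_le (hN : 0 < N) (hlam : 0 < lam) (hmu : 0 < mu)
    (hf : ∀ i, StronglyConvex mu (f i)) (w : Model d) :
    (1 / (N : ℝ)) * ∑ i, ‖moreauGrad lam (f i) w‖ ^ 2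
      ≤ 4 * lam * (globalObj lam f w - globalObj lam f (wStar lam f)) + 2 * sigmaSq lam f := by
  -- As `∇F(w*) = 0`, the mean Bregman divergence at `w*` is exactly `F(w) - F(w*)`; co-coercivity
  -- of each client then controls `∇F_i(w) - ∇F_i(w*)`.
  have h1 := globalObj_bregman lam f w (wStar lam f)
  rw [globalGrad_wStar hN hlam hmu hf, inner_zero_left, sub_zero] at h1
  rw [h1, sigmaSq_eq hlam hmu hf, Finset.mul_sum, Finset.mul_sum, Finset.mul_sum, Finset.mul_sum,
    Finset.mul_sum, ← Finset.sum_add_distrib]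
  refine Finset.sum_le_sum fun i _ => ?_
  have h2 := norm_moreauGrad_sub_sq_le hlam hmu (hf i) w (wStar lam f)
  set a := moreauGrad lam (f i) w
  set b := moreauGrad lam (f i) (wStar lam f)
  have h3 : ‖a‖ ^ 2 ≤ 2 * ‖a - b‖ ^ 2 + 2 * ‖b‖ ^ 2 := by
    have : ‖a‖ ≤ ‖a - b‖ + ‖b‖ := by simpa using norm_add_le (a - b) b
    nlinarith [norm_nonneg a, sq_nonneg (‖a - b‖ - ‖b‖)]
  have h4 : 0 ≤ 1 / (N : ℝ) := by positivity
  nlinarith [mul_le_mul_of_nonneg_left (h3.trans (add_le_add_left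
    (mul_le_mul_of_nonneg_left h2 zero_le_two) _)) h4]

theorem globalObj_bregman_le (hN : 0 < N) (hlam : 0 < lam) (hmu : 0 < mu)
    (hf : ∀ i, StronglyConvex mu (f i)) (x w : Model d) :
    globalObj lam f x - globalObj lam f w - inner ℝ (globalGrad lam f w) (x - w)
      ≤ lam / 2 * ‖x - w‖ ^ 2 := by
  rw [globalObj_bregman]
  have : (N : ℝ) ≠ 0 := by positivity
  calc _ ≤ (1 / (N : ℝ)) * ∑ _i : Fin N, lam / 2 * ‖x - w‖ ^ 2 := by
        refine mul_le_mul_of_nonneg_left (Finset.sum_le_sum fun i _ => ?_) (by positivity)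
        exact moreau_bregman_le hlam hmu (hf i) x w
    _ = _ := by simp; field_simp

theorem globalObj_sub_wStar_le (hN : 0 < N) (hlam : 0 < lam) (hmu : 0 < mu)
    (hf : ∀ i, StronglyConvex mu (f i)) (w : Model d) :
    globalObj lam f w - globalObj lam f (wStar lam f) ≤ lam / 2 * ‖w - wStar lam f‖ ^ 2 := by
  have h := globalObj_bregman_le hN hlam hmu hf w (wStar lam f)
  rwa [globalGrad_wStar hN hlam hmu hf, inner_zero_left, sub_zero] at h

/-- A gradient step of length `1 / lam` lowers `F` by at least `‖∇F‖² / (2 lam)` and cannot go below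
the minimum. -/
theorem norm_globalGrad_sq_le (hN : 0 < N) (hlam : 0 < lam) (hmu : 0 < mu)
    (hf : ∀ i, StronglyConvex mu (f i)) (w : Model d) :
    ‖globalGrad lam f w‖ ^ 2
      ≤ 2 * lam * (globalObj lam f w - globalObj lam f (wStar lam f)) := by
  have h1 := globalObj_bregman_le hN hlam hmu hf (w - (1 / lam) • globalGrad lam f w) w
  have h2 := globalObj_wStar_le hN hlam hmu hf (w - (1 / lam) • globalGrad lam f w)
  rw [sub_sub_cancel_left, inner_neg_right, inner_smul_right, real_inner_self_eq_norm_sq,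
    norm_neg, norm_smul, mul_pow, Real.norm_eq_abs, sq_abs] at h1
  have h3 : lam / 2 * ((1 / lam) ^ 2 * ‖globalGrad lam f w‖ ^ 2)
      = 1 / (2 * lam) * ‖globalGrad lam f w‖ ^ 2 := by field_simp
  have h4 : 1 / lam * ‖globalGrad lam f w‖ ^ 2
      = 2 * (1 / (2 * lam) * ‖globalGrad lam f w‖ ^ 2) := by field_simp
  rw [h3, h4] at h1
  have h5 : 1 / (2 * lam) * ‖globalGrad lam f w‖ ^ 2
      ≤ globalObj lam f w - globalObj lam f (wStar lam f) := by linarith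
  rwa [one_div, inv_mul_le_iff₀ (by positivity)] at h5

/-- Jensen's inequality for the global objective. -/
theorem globalObj_weighted_mean_le (hN : 0 < N) (hlam : 0 < lam) (hmu : 0 < mu)
    (hf : ∀ i, StronglyConvex mu (f i)) {ι : Type*} (s : Finset ι) {α : ι → ℝ}
    (hα : ∀ t ∈ s, 0 ≤ α t) (hA : 0 < ∑ t ∈ s, α t) (x : ι → Model d) (c : ℝ) :
    globalObj lam f ((∑ t ∈ s, α t)⁻¹ • ∑ t ∈ s, α t • x t) - c
      ≤ (∑ t ∈ s, α t)⁻¹ * ∑ t ∈ s, α t * (globalObj lam f (x t) - c) := by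
  set A := ∑ t ∈ s, α t with hAdef
  set z := A⁻¹ • ∑ t ∈ s, α t • x t with hz
  have h1 : ∀ t ∈ s, α t * (globalObj lam f z - c)
      + inner ℝ (gradient (globalObj lam f) z) (α t • (x t - z))
      ≤ α t * (globalObj lam f (x t) - c) := by
    intro t ht
    have h2 := (stronglyConvex_globalObj hN hlam hmu hf).2 (x t) z
    have h3 : 0 ≤ muF lam mu / 2 * ‖x t - z‖ ^ 2 := by
      have := muF_pos hlam hmu
      positivity
    rw [inner_smul_right, ← mul_add]
    exact mul_le_mul_of_nonneg_left (by linarith) (hα t ht)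
  have h4 := Finset.sum_le_sum h1
  -- The linear terms of the first-order inequalities at the mean cancel.
  have h5 : ∑ t ∈ s, α t • (x t - z) = 0 := by
    simp only [smul_sub, Finset.sum_sub_distrib, ← Finset.sum_smul]
    rw [← hAdef, hz, smul_smul, mul_inv_cancel₀ hA.ne', one_smul, sub_self]
  rw [Finset.sum_add_distrib, ← inner_sum, h5, inner_zero_right, add_zero, ← Finset.sum_mul,
    ← hAdef] at h4
  rwa [le_inv_mul_iff₀ hA]

end Global

/-! ### Uniform sampling of clients without replacement. -/

section Sampling

variable {N : ℕ}

theorem sum_powersetCard_map (S : ℕ) (σ : Equiv.Perm (Fin N)) (h : Finset (Fin N) → ℝ) :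
    ∑ s ∈ Finset.powersetCard S Finset.univ, h (s.map σ.toEmbedding)
      = ∑ s ∈ Finset.powersetCard S Finset.univ, h s := by
  refine Finset.sum_nbij' (fun s => s.map σ.toEmbedding) (fun s => s.map σ.symm.toEmbedding)
    ?_ ?_ ?_ ?_ ?_
  · intro s hs; simpa [Finset.mem_powersetCard] using hs
  · intro s hs; simpa [Finset.mem_powersetCard] using hs
  · intro s _; ext; simp
  · intro s _; ext; simp
  · intro s _; rfl

/-- The number of `S`-element sets that contain both `i` and `j`. -/
def pairCount (S : ℕ) (i j : Fin N) : ℝ :=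
  ∑ s ∈ Finset.powersetCard S (Finset.univ : Finset (Fin N)),
    (if i ∈ s then (1 : ℝ) else 0) * (if j ∈ s then (1 : ℝ) else 0)

/-- By this symmetry `pairCount` takes one value on the diagonal and one off it, so double counting
determines both. -/
theorem pairCount_perm (S : ℕ) (σ : Equiv.Perm (Fin N)) (i j : Fin N) :
    pairCount S (σ i) (σ j) = pairCount S i j := by
  unfold pairCount
  rw [← sum_powersetCard_map S σ]
  simp

theorem sum_ite_mem (s : Finset (Fin N)) : ∑ i, (if i ∈ s then (1 : ℝ) else 0) = s.card := by
  simp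

theorem sum_pairCount (S : ℕ) (i : Fin N) :
    ∑ j, pairCount S i j = S * pairCount S i i := by
  unfold pairCount
  rw [Finset.sum_comm, Finset.mul_sum]
  refine Finset.sum_congr rfl fun s hs => ?_
  rw [← Finset.mul_sum, sum_ite_mem, (Finset.mem_powersetCard.1 hs).2]
  split_ifs <;> simp

theorem pairCount_self_eq (S : ℕ) (i j : Fin N) : pairCount S i i = pairCount S j j := by
  simpa using pairCount_perm S (Equiv.swap i j) j j

theorem card_mul_pairCount_self (S : ℕ) (i : Fin N) :
    (N : ℝ) * pairCount S i i = S * (N.choose S : ℝ) := by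
  have h : ∑ j : Fin N, pairCount S j j = S * (N.choose S : ℝ) := by
    unfold pairCount
    rw [Finset.sum_comm]
    have : ∀ s ∈ Finset.powersetCard S (Finset.univ : Finset (Fin N)),
        ∑ j, (if j ∈ s then (1 : ℝ) else 0) * (if j ∈ s then (1 : ℝ) else 0) = S := by
      intro s hs
      rw [← (Finset.mem_powersetCard.1 hs).2, ← sum_ite_mem]
      refine Finset.sum_congr rfl fun j _ => ?_
      split_ifs <;> simp
    rw [Finset.sum_congr rfl this]
    simp [Finset.card_powersetCard, mul_comm]
  rw [← h, Finset.sum_congr rfl fun j _ => pairCount_self_eq S j i]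
  simp

/-- The form matters: a constant plus a diagonal part. In `∑ i j, pairCount i j * ⟪v i, v j⟫` the
constant part vanishes as soon as `∑ v i = 0`. -/
theorem pairCount_eq (S : ℕ) (i j : Fin N) :
    ((N : ℝ) - 1) * pairCount S i j
      = (S - 1) * pairCount S i i + if i = j then ((N : ℝ) - S) * pairCount S i i else 0 := by
  split_ifs with hij
  · subst hij; ring
  · have h1 : ∀ k ∈ Finset.univ.erase i, pairCount S i k = pairCount S i j := by
      intro k hk
      have hki : k ≠ i := Finset.ne_of_mem_erase hk
      have := pairCount_perm S (Equiv.swap j k) i j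
      rwa [Equiv.swap_apply_of_ne_of_ne hij (Ne.symm hki), Equiv.swap_apply_left] at this
    have h2 := sum_pairCount S i
    rw [← Finset.add_sum_erase _ _ (Finset.mem_univ i), Finset.sum_congr rfl h1] at h2
    rw [Finset.sum_const, Finset.card_erase_of_mem (Finset.mem_univ i), Finset.card_univ,
      Fintype.card_fin, nsmul_eq_mul, Nat.cast_sub (Fin.pos i)] at h2
    push_cast at h2
    linarith

/-- The mean of `h` over a uniformly random `S`-element set. -/
def subsetMean (S : ℕ) (h : Finset (Fin N) → ℝ) : ℝ :=
  (N.choose S : ℝ)⁻¹ * ∑ s ∈ Finset.powersetCard S Finset.univ, h s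

theorem subsetMean_mono {S : ℕ} {h k : Finset (Fin N) → ℝ} (hk : ∀ s, s.card = S → h s ≤ k s) :
    subsetMean S h ≤ subsetMean S k :=
  mul_le_mul_of_nonneg_left
    (Finset.sum_le_sum fun s hs => hk s (Finset.mem_powersetCard.1 hs).2) (by positivity)

theorem subsetMean_congr {S : ℕ} {h k : Finset (Fin N) → ℝ} (hk : ∀ s, s.card = S → h s = k s) :
    subsetMean S h = subsetMean S k :=
  le_antisymm (subsetMean_mono fun s hs => (hk s hs).le) (subsetMean_mono fun s hs => (hk s hs).ge)

theorem subsetMean_add (S : ℕ) (h k : Finset (Fin N) → ℝ) :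
    subsetMean S (fun s => h s + k s) = subsetMean S h + subsetMean S k := by
  simp only [subsetMean, Finset.sum_add_distrib, mul_add]

theorem subsetMean_const_mul (S : ℕ) (c : ℝ) (h : Finset (Fin N) → ℝ) :
    subsetMean S (fun s => c * h s) = c * subsetMean S h := by
  simp only [subsetMean, ← Finset.mul_sum]
  ring

theorem subsetMean_const {S : ℕ} (hS : S ≤ N) (c : ℝ) :
    subsetMean (N := N) S (fun _ => c) = c := by
  have : (N.choose S : ℝ) ≠ 0 := by exact_mod_cast (Nat.choose_pos hS).ne'
  simp [subsetMean, Finset.card_powersetCard, this]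

theorem sum_mem_eq (s : Finset (Fin N)) (a : Fin N → ℝ) :
    ∑ i ∈ s, a i = ∑ i, (if i ∈ s then (1 : ℝ) else 0) * a i := by
  simp only [ite_mul, one_mul, zero_mul, Finset.sum_ite_mem, Finset.univ_inter]

theorem subsetMean_mean {S : ℕ} (hS0 : 0 < S) (hS : S ≤ N) (a : Fin N → ℝ) :
    subsetMean S (fun s => (1 / (S : ℝ)) * ∑ i ∈ s, a i) = (1 / (N : ℝ)) * ∑ i, a i := by
  have hC : (N.choose S : ℝ) ≠ 0 := by exact_mod_cast (Nat.choose_pos hS).ne'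
  have hSr : (S : ℝ) ≠ 0 := by positivity
  have hNr : (N : ℝ) ≠ 0 := by exact_mod_cast (hS0.trans_le hS).ne'
  rw [subsetMean_const_mul, subsetMean, Finset.sum_congr rfl fun s _ => sum_mem_eq s a,
    Finset.sum_comm]
  have h1 : ∀ i : Fin N, ∑ s ∈ Finset.powersetCard S (Finset.univ : Finset (Fin N)),
      (if i ∈ s then (1 : ℝ) else 0) * a i = S * (N.choose S : ℝ) / N * a i := by
    intro i
    rw [← Finset.sum_mul, ← card_mul_pairCount_self S i, mul_div_cancel_left₀ _ hNr, pairCount]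
    congr 1
    refine Finset.sum_congr rfl fun s _ => ?_
    split_ifs <;> simp
  rw [Finset.sum_congr rfl fun i _ => h1 i, ← Finset.mul_sum]
  field_simp

variable {E : Type*} [NormedAddCommGroup E] [InnerProductSpace ℝ E]

theorem norm_mean_sq_le {ι : Type*} (s : Finset ι) {n : ℕ} (hn : s.card = n) (v : ι → E) :
    ‖(1 / (n : ℝ)) • ∑ i ∈ s, v i‖ ^ 2 ≤ (1 / (n : ℝ)) * ∑ i ∈ s, ‖v i‖ ^ 2 := by
  rcases Nat.eq_zero_or_pos n with h0 | h0
  · simp [h0]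
  have h1 : ‖∑ i ∈ s, v i‖ ^ 2 ≤ n * ∑ i ∈ s, ‖v i‖ ^ 2 := by
    rw [← hn]
    exact (pow_le_pow_left₀ (norm_nonneg _) (norm_sum_le _ _) 2).trans sq_sum_le_card_mul_sum_sq
  rw [norm_smul, mul_pow, Real.norm_of_nonneg (by positivity)]
  calc (1 / (n : ℝ)) ^ 2 * ‖∑ i ∈ s, v i‖ ^ 2
      ≤ (1 / (n : ℝ)) ^ 2 * (n * ∑ i ∈ s, ‖v i‖ ^ 2) := by gcongr
    _ = _ := by field_simp

/-- The variance of the mean of a random sample without replacement. -/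
theorem subsetMean_norm_sq {S : ℕ} (hS0 : 0 < S) (hS : S ≤ N) (v : Fin N → E)
    (hv : ∑ i, v i = 0) :
    subsetMean S (fun s => ‖(1 / (S : ℝ)) • ∑ i ∈ s, v i‖ ^ 2)
      = ((N : ℝ) - S) / (S * (N - 1)) * ((1 / (N : ℝ)) * ∑ i, ‖v i‖ ^ 2) := by
  rcases Nat.lt_or_ge 1 N with hN | hN
  · have hC : (N.choose S : ℝ) ≠ 0 := by exact_mod_cast (Nat.choose_pos hS).ne'
    have hSr : (S : ℝ) ≠ 0 := by positivity
    have hNr : (N : ℝ) ≠ 0 := by positivity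
    have hN1 : (N : ℝ) - 1 ≠ 0 := by
      have : (1 : ℝ) < N := by exact_mod_cast hN
      linarith
    have key : ((N : ℝ) - 1) * ∑ s ∈ Finset.powersetCard S (Finset.univ : Finset (Fin N)),
        ‖∑ i ∈ s, v i‖ ^ 2 = ((N : ℝ) - S) * (S * (N.choose S : ℝ) / N) * ∑ i, ‖v i‖ ^ 2 := by
      have h1 : ∀ s : Finset (Fin N), ‖∑ i ∈ s, v i‖ ^ 2
          = ∑ i, ∑ j, ((if i ∈ s then (1 : ℝ) else 0) * (if j ∈ s then (1 : ℝ) else 0))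
              * inner ℝ (v i) (v j) := by
        intro s
        rw [← real_inner_self_eq_norm_sq, sum_inner, sum_mem_eq]
        refine Finset.sum_congr rfl fun i _ => ?_
        rw [inner_sum, sum_mem_eq, Finset.mul_sum]
        refine Finset.sum_congr rfl fun j _ => ?_
        ring
      simp only [h1]
      have h2 : ∀ i : Fin N, pairCount S i i = S * (N.choose S : ℝ) / N := fun i => by
        rw [← card_mul_pairCount_self S i, mul_div_cancel_left₀ _ hNr]
      rw [Finset.sum_comm, Finset.mul_sum, Finset.mul_sum]
      refine Finset.sum_congr rfl fun i _ => ?_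
      rw [Finset.sum_comm, Finset.mul_sum]
      have h3 : ∀ j : Fin N, ((N : ℝ) - 1) * ∑ s ∈ Finset.powersetCard S Finset.univ,
          ((if i ∈ s then (1 : ℝ) else 0) * (if j ∈ s then (1 : ℝ) else 0)) * inner ℝ (v i) (v j)
          = (S - 1) * (S * (N.choose S : ℝ) / N) * inner ℝ (v i) (v j)
            + if i = j then ((N : ℝ) - S) * (S * (N.choose S : ℝ) / N) * ‖v i‖ ^ 2 else 0 := by
        intro j
        rw [← Finset.sum_mul, ← mul_assoc]
        have h4 := pairCount_eq S i j
        rw [h2 i, pairCount] at h4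
        rw [h4]
        split_ifs with hij
        · subst hij
          rw [real_inner_self_eq_norm_sq]
          ring
        · ring
      rw [Finset.sum_congr rfl fun j _ => h3 j, Finset.sum_add_distrib, ← Finset.mul_sum,
        ← inner_sum, hv, inner_zero_right]
      simp
    rw [show (fun s : Finset (Fin N) => ‖(1 / (S : ℝ)) • ∑ i ∈ s, v i‖ ^ 2)
        = fun s => (1 / (S : ℝ)) ^ 2 * ‖∑ i ∈ s, v i‖ ^ 2 from funext fun s => by
          rw [norm_smul, mul_pow, Real.norm_of_nonneg (by positivity)],
      subsetMean_const_mul, subsetMean]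
    rw [← mul_right_inj' hN1]
    calc _ = (1 / (S : ℝ)) ^ 2 * (N.choose S : ℝ)⁻¹ * (((N : ℝ) - 1) *
          ∑ s ∈ Finset.powersetCard S (Finset.univ : Finset (Fin N)), ‖∑ i ∈ s, v i‖ ^ 2) := by ring
      _ = _ := by
        rw [key]
        field_simp
  -- For `N = 1` the variance factor is `0 / 0`, which is `0` by convention; this is the true
  -- variance.
  · have hN' : N = 1 := by omega
    subst hN'
    have hS' : S = 1 := by omega
    subst hS'
    rw [subsetMean_congr (k := fun _ => 0)]
    · simp [subsetMean]
    · intro s hs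
      have : s = Finset.univ := by
        rw [← Finset.card_eq_iff_eq_univ, hs]; rfl
      rw [this, hv]
      simp

end Sampling

/-! ### Local updates: drift and accuracy of the update direction. -/

section Local

variable {d : ℕ}

theorem localModel_eq (lam eta : ℝ) (θ : ℕ → Model d) (w : Model d) (r : ℕ) :
    localModel lam eta θ w r
      = w - (eta * lam) • ∑ k ∈ Finset.range r, (localModel lam eta θ w k - θ k) := by
  induction r with
  | zero => simp [localModel]
  | succ r ih =>
    rw [localModel, Finset.sum_range_succ, smul_add, ← sub_sub, ← ih]

variable {mu lam eta : ℝ} {f : Model d → ℝ}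

/-- Exact steps are nonexpansive, so comparing with the exact step from `w` shows that each step
adds at most `eta ‖∇F_i(w)‖` plus its own inexactness. The drift grows linearly in `r`, with no
exponential factor. -/
theorem norm_localModel_sub_le (hlam : 0 < lam) (hmu : 0 < mu) (hf : StronglyConvex mu f)
    (h0 : 0 ≤ eta) (h1 : eta * lam ≤ 1) (θ : ℕ → Model d) (w : Model d) (r : ℕ) :
    ‖localModel lam eta θ w r - w‖ ≤ eta * r * ‖moreauGrad lam f w‖
      + eta * lam * ∑ k ∈ Finset.range r, ‖θ k - prox lam f (localModel lam eta θ w k)‖ := by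
  induction r with
  | zero => simp [localModel]
  | succ r ih =>
    rw [Finset.sum_range_succ, localModel]
    set x := localModel lam eta θ w r
    have e : x - (eta * lam) • (x - θ r) - w
        = ((x - eta • moreauGrad lam f x) - (w - eta • moreauGrad lam f w))
          - eta • moreauGrad lam f w + (eta * lam) • (θ r - prox lam f x) := by
      rw [show moreauGrad lam f x = lam • (x - prox lam f x) from rfl]
      module
    have h2 := norm_prox_step_sub_le hlam hmu hf (mul_nonneg h0 hlam.le) h1 x w
    rw [e]
    refine (norm_add_le _ _).trans ((add_le_add_left (norm_sub_le _ _) _).trans ?_)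
    rw [norm_smul, norm_smul, Real.norm_of_nonneg h0, Real.norm_of_nonneg (mul_nonneg h0 hlam.le)]
    push_cast
    linarith

/-- The mean update direction of a client over `R` local steps. -/
def localDir (lam eta : ℝ) (θ : ℕ → Model d) (w : Model d) (R : ℕ) : Model d :=
  (1 / (R : ℝ)) • ∑ r ∈ Finset.range R, lam • (localModel lam eta θ w r - θ r)

theorem localModel_eq_localDir {R : ℕ} (hR : 0 < R) (lam eta : ℝ) (θ : ℕ → Model d) (w : Model d) :
    localModel lam eta θ w R = w - (eta * R) • localDir lam eta θ w R := by
  have : (R : ℝ) ≠ 0 := by positivity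
  rw [localModel_eq, localDir, ← Finset.smul_sum, smul_smul, smul_smul]
  congr 2
  field_simp

/-- The mean squared error of the personalized models computed by a client in one round. -/
def localErr (lam eta : ℝ) (f : Model d → ℝ) (θ : ℕ → Model d) (w : Model d) (R : ℕ) : ℝ :=
  (1 / (R : ℝ)) * ∑ r ∈ Finset.range R, ‖θ r - prox lam f (localModel lam eta θ w r)‖ ^ 2

theorem localErr_nonneg (lam eta : ℝ) (f : Model d → ℝ) (θ : ℕ → Model d) (w : Model d) (R : ℕ) :
    0 ≤ localErr lam eta f θ w R := by
  unfold localErr; positivity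

/-- Since `∇F_i` is `lam`-Lipschitz, the drift changes the direction only by the small factor `(eta
R lam)²`, while the inaccuracy enters with a factor of order one. -/
theorem norm_localDir_sub_sq_le (hlam : 0 < lam) (hmu : 0 < mu) (hf : StronglyConvex mu f)
    (h0 : 0 ≤ eta) (h1 : eta * lam ≤ 1) {R : ℕ} (hR : 0 < R) (θ : ℕ → Model d) (w : Model d) :
    ‖localDir lam eta θ w R - moreauGrad lam f w‖ ^ 2
      ≤ (2 + 4 * (eta * R * lam) ^ 2) * lam ^ 2 * localErr lam eta f θ w R
        + 4 * (eta * R * lam) ^ 2 * ‖moreauGrad lam f w‖ ^ 2 := by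
  have hRr : (0 : ℝ) < R := by positivity
  set x := localModel lam eta θ w with hx
  set e := localErr lam eta f θ w R with he
  set G := moreauGrad lam f w with hG
  have hdrift : ∀ r ∈ Finset.range R,
      ‖x r - w‖ ^ 2 ≤ 2 * (eta * R) ^ 2 * ‖G‖ ^ 2 + 2 * (eta * R * lam) ^ 2 * e := by
    intro r hr
    have h2 := norm_localModel_sub_le hlam hmu hf h0 h1 θ w r
    have h3 : ∑ k ∈ Finset.range r, ‖θ k - prox lam f (x k)‖
        ≤ ∑ k ∈ Finset.range R, ‖θ k - prox lam f (x k)‖ :=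
      Finset.sum_le_sum_of_subset_of_nonneg
        (Finset.range_mono (Finset.mem_range.1 hr).le) fun _ _ _ => norm_nonneg _
    have h4 : (∑ k ∈ Finset.range R, ‖θ k - prox lam f (x k)‖) ^ 2 ≤ R ^ 2 * e := by
      refine sq_sum_le_card_mul_sum_sq.trans (le_of_eq ?_)
      rw [he, localErr, Finset.card_range]
      field_simp
      rfl
    have h5 : (r : ℝ) ≤ R := by exact_mod_cast (Finset.mem_range.1 hr).le
    have h6 : ‖x r - w‖ ≤ eta * R * ‖G‖
        + eta * lam * ∑ k ∈ Finset.range R, ‖θ k - prox lam f (x k)‖ := by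
      refine h2.trans ?_
      gcongr
    have h7 : 0 ≤ ∑ k ∈ Finset.range R, ‖θ k - prox lam f (x k)‖ :=
      Finset.sum_nonneg fun _ _ => norm_nonneg _
    generalize ∑ k ∈ Finset.range R, ‖θ k - prox lam f (x k)‖ = s at *
    calc ‖x r - w‖ ^ 2 ≤ (eta * R * ‖G‖ + eta * lam * s) ^ 2 :=
          pow_le_pow_left₀ (norm_nonneg _) h6 2
      _ ≤ 2 * (eta * R * ‖G‖) ^ 2 + 2 * (eta * lam * s) ^ 2 := by
          nlinarith [sq_nonneg (eta * R * ‖G‖ - eta * lam * s)]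
      _ = 2 * (eta * R) ^ 2 * ‖G‖ ^ 2 + 2 * (eta * lam) ^ 2 * s ^ 2 := by ring
      _ ≤ 2 * (eta * R) ^ 2 * ‖G‖ ^ 2 + 2 * (eta * lam) ^ 2 * (R ^ 2 * e) := by gcongr
      _ = _ := by ring
  have hterm : ∀ r ∈ Finset.range R, ‖lam • (x r - θ r) - G‖ ^ 2
      ≤ 2 * lam ^ 2 * (2 * (eta * R) ^ 2 * ‖G‖ ^ 2 + 2 * (eta * R * lam) ^ 2 * e)
        + 2 * lam ^ 2 * ‖θ r - prox lam f (x r)‖ ^ 2 := by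
    intro r hr
    have e1 : lam • (x r - θ r) - G
        = (moreauGrad lam f (x r) - G) - lam • (θ r - prox lam f (x r)) := by
      rw [show moreauGrad lam f (x r) = lam • (x r - prox lam f (x r)) from rfl]
      module
    have h2 := norm_moreauGrad_sub_le hlam hmu hf (x r) w
    have h3 : ‖lam • (x r - θ r) - G‖ ≤ lam * ‖x r - w‖ + lam * ‖θ r - prox lam f (x r)‖ := by
      rw [e1]
      refine (norm_sub_le _ _).trans ?_
      rw [norm_smul, Real.norm_of_nonneg hlam.le]
      linarith
    calc ‖lam • (x r - θ r) - G‖ ^ 2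
        ≤ (lam * ‖x r - w‖ + lam * ‖θ r - prox lam f (x r)‖) ^ 2 :=
          pow_le_pow_left₀ (norm_nonneg _) h3 2
      _ ≤ 2 * lam ^ 2 * ‖x r - w‖ ^ 2 + 2 * lam ^ 2 * ‖θ r - prox lam f (x r)‖ ^ 2 := by
          nlinarith [sq_nonneg (lam * ‖x r - w‖ - lam * ‖θ r - prox lam f (x r)‖)]
      _ ≤ _ := by have := hdrift r hr; gcongr
  have e2 : localDir lam eta θ w R - G
      = (1 / (R : ℝ)) • ∑ r ∈ Finset.range R, (lam • (x r - θ r) - G) := by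
    rw [Finset.sum_sub_distrib, smul_sub, Finset.sum_const, Finset.card_range, localDir,
      ← Nat.cast_smul_eq_nsmul ℝ, smul_smul, one_div_mul_cancel hRr.ne', one_smul]
  rw [e2]
  refine (norm_mean_sq_le _ (Finset.card_range R) _).trans ?_
  refine (mul_le_mul_of_nonneg_left (Finset.sum_le_sum hterm) (by positivity)).trans ?_
  rw [Finset.sum_add_distrib, ← Finset.mul_sum (Finset.range R) (fun r => ‖θ r - prox lam f (x r)‖ ^ 2),
    Finset.sum_const, Finset.card_range, nsmul_eq_mul]
  have e3 : ∑ r ∈ Finset.range R, ‖θ r - prox lam f (x r)‖ ^ 2 = R * e := by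
    rw [he, localErr]; field_simp; rfl
  rw [e3]
  refine le_of_eq ?_
  field_simp
  ring

end Local

/-! ### Step-size restrictions and the constants of one round. -/

section StepSize

variable {lam mu beta tau : ℝ}

theorem etaHat_pos (hlam : 0 < lam) (hmu : 0 < mu) (hb : 1 ≤ beta) : 0 < etaHat lam mu beta := by
  have := muF_pos hlam hmu
  unfold etaHat kappaF
  positivity

/-- What the upper bound on the effective step size gives. -/
theorem step_bounds (hlam : 0 < lam) (hmu : 0 < mu) (hb : 1 ≤ beta)
    (ht : tau ≤ etaHat lam mu beta) (ht0 : 0 ≤ tau) :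
    18 * lam * tau ≤ 1 ∧ 768 * (lam / muF lam mu) * (lam * tau / beta) ≤ 1 := by
  have hm := muF_pos hlam hmu
  have h1 : tau * (6 * lam * (3 + 128 * kappaF lam mu / beta)) ≤ 1 := by
    rw [etaHat, le_div_iff₀ (by unfold kappaF; positivity)] at ht
    exact ht
  have h2 : tau * (6 * lam * (3 + 128 * kappaF lam mu / beta))
      = 18 * lam * tau + 768 * (lam / muF lam mu) * (lam * tau / beta) := by
    unfold kappaF; ring
  rw [h2] at h1
  have h3 : 0 ≤ 768 * (lam / muF lam mu) * (lam * tau / beta) := by positivity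
  have h4 : 0 ≤ 18 * lam * tau := by positivity
  constructor <;> linarith

/-- The scalar inequality behind one round of the algorithm. -/
theorem round_scalar {m Φ σ e M V D G X z q : ℝ} (hlam : 0 < lam) (hm : 0 < m) (hml : m ≤ lam)
    (ht0 : 0 < tau) (h18 : 18 * lam * tau ≤ 1) (hq0 : 0 ≤ q)
    (hqL : 32 * q * lam ≤ m / 4) (hq : 324 * q ≤ 1)
    (hΦ : 0 ≤ Φ) (hσ : 0 ≤ σ) (he : 0 ≤ e) (hz0 : 0 ≤ z) (hz1 : z ≤ 1)
    (hM : M ≤ 4 * lam * Φ + 2 * σ) (hV : V ≤ z * M)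
    (hD : D ≤ (2 + 4 * q) * e + 4 * q * M) (hG : G ≤ 2 * lam * Φ) :
    (1 - tau * m / 2) * X - 2 * tau * Φ + (2 * tau / m + 3 * tau ^ 2) * D
        + 3 * tau ^ 2 * V + 3 * tau ^ 2 * G
      ≤ (1 - tau * m / 2) * X - tau / 2 * Φ + 6 * tau ^ 2 * z * σ + 24 * (tau * q / m) * σ
        + 7 * tau / m * e := by
  -- This only needs `3 tau m ≤ 1`.
  have hA : 2 * tau / m + 3 * tau ^ 2 ≤ 3 * tau / m := by
    rw [div_add' _ _ _ hm.ne', div_le_div_iff_of_pos_right hm]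
    nlinarith [mul_le_mul_of_nonneg_left hml ht0.le, mul_pos ht0 hm]
  have hD' : D ≤ (2 + 4 * q) * e + 4 * q * (4 * lam * Φ + 2 * σ) := hD.trans (by gcongr)
  have hR : 0 ≤ (2 + 4 * q) * e + 4 * q * (4 * lam * Φ + 2 * σ) := by positivity
  have h1 : (2 * tau / m + 3 * tau ^ 2) * D
      ≤ 3 * tau / m * ((2 + 4 * q) * e + 4 * q * (4 * lam * Φ + 2 * σ)) :=
    (mul_le_mul_of_nonneg_left hD' (by positivity)).trans (mul_le_mul_of_nonneg_right hA hR)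
  have h2 : V ≤ 4 * lam * Φ + z * (2 * σ) := by
    have : z * M ≤ z * (4 * lam * Φ + 2 * σ) := by gcongr
    have h4 : z * (4 * lam * Φ) ≤ 4 * lam * Φ := mul_le_of_le_one_left (by positivity) hz1
    linarith
  have h3 : 3 * tau ^ 2 * V + 3 * tau ^ 2 * G
      ≤ tau * (18 * lam * tau) * Φ + 6 * tau ^ 2 * z * σ := by
    have := mul_le_mul_of_nonneg_left (add_le_add h2 hG) (show 0 ≤ 3 * tau ^ 2 by positivity)
    linarith
  -- The available decrease is `2 tau Φ`. Sampling and the mean gradient consume `tau Φ` of it here,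
  -- the drift consumes `3/8 tau Φ` in the next step, and at least `tau / 2 * Φ` is left.
  have h4 : tau * (18 * lam * tau) * Φ ≤ tau * 1 * Φ := by gcongr
  have h5 : 3 * tau / m * (4 * q * (4 * lam * Φ)) ≤ tau / 2 * Φ := by
    have : 3 * tau / m * (4 * q * (4 * lam * Φ)) = tau * Φ / m * (3 / 2 * (32 * q * lam)) := by ring
    rw [this]
    calc _ ≤ tau * Φ / m * (3 / 2 * (m / 4)) := by gcongr
      _ = 3 / 8 * (tau * Φ) := by field_simp; ring
      _ ≤ _ := by nlinarith [mul_nonneg ht0.le hΦ]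
  -- The constant `7` bounds `6 + 12 q`, as `q ≤ 1 / 324`.
  have h6 : 3 * tau / m * ((2 + 4 * q) * e) ≤ 7 * tau / m * e := by
    have : 3 * tau / m * ((2 + 4 * q) * e) = tau / m * e * (6 + 12 * q) := by ring
    rw [this, show 7 * tau / m * e = tau / m * e * 7 by ring]
    gcongr
    linarith
  have h7 : 3 * tau / m * (4 * q * (2 * σ)) = 24 * (tau * q / m) * σ := by ring
  have h8 : 3 * tau / m * ((2 + 4 * q) * e + 4 * q * (4 * lam * Φ + 2 * σ))
      = 3 * tau / m * ((2 + 4 * q) * e) + 3 * tau / m * (4 * q * (4 * lam * Φ))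
        + 3 * tau / m * (4 * q * (2 * σ)) := by ring
  linarith

end StepSize

/-! ### One round, averaged over the sampled clients. -/

section Round

variable {d N : ℕ} {mu lam beta eta : ℝ} {f : Fin N → Model d → ℝ}

theorem norm_add_three_sq_le {E : Type*} [SeminormedAddCommGroup E] (a b c : E) :
    ‖a + b + c‖ ^ 2 ≤ 3 * ‖a‖ ^ 2 + 3 * ‖b‖ ^ 2 + 3 * ‖c‖ ^ 2 := by
  have h : ‖a + b + c‖ ≤ ‖a‖ + ‖b‖ + ‖c‖ := norm_add₃_le
  have h2 := pow_le_pow_left₀ (norm_nonneg _) h 2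
  nlinarith [sq_nonneg (‖a‖ - ‖b‖), sq_nonneg (‖b‖ - ‖c‖), sq_nonneg (‖a‖ - ‖c‖)]

/-- The last bound replaces `N - 1` by `N` at the cost of a factor `2`; for `N = S = 1` all these
expressions are `0`. -/
theorem sampling_factor {S : ℕ} (hS0 : 0 < S) (hS : S ≤ N) :
    0 ≤ ((N : ℝ) - S) / (S * (N - 1)) ∧ ((N : ℝ) - S) / (S * (N - 1)) ≤ 1 ∧
      ((N : ℝ) - S) / (S * (N - 1)) ≤ 2 * (((N : ℝ) / S - 1) / N) := by
  have hSr : (1 : ℝ) ≤ S := by exact_mod_cast hS0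
  have hSN : (S : ℝ) ≤ N := by exact_mod_cast hS
  rcases Nat.lt_or_ge 1 N with hN | hN
  · have hNr : (2 : ℝ) ≤ N := by exact_mod_cast hN
    have h1 : (0 : ℝ) < S * (N - 1) := mul_pos (by linarith) (by linarith)
    refine ⟨div_nonneg (by linarith) h1.le, ?_, ?_⟩
    · rw [div_le_one h1]; nlinarith
    · rw [div_sub_one (by linarith), div_div, ← mul_div_assoc,
        div_le_div_iff₀ h1 (by positivity)]
      have : 0 ≤ ((N : ℝ) - S) * S * (N - 2) :=
        mul_nonneg (mul_nonneg (by linarith) (by linarith)) (by linarith)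
      nlinarith
  · have hN' : N = 1 := by omega
    have hS' : S = 1 := by omega
    subst hN' hS'
    norm_num

/-- The second moment of a sampled update direction. -/
theorem subsetMean_norm_mean_sq_le {S : ℕ} (hS0 : 0 < S) (hS : S ≤ N) (v G : Fin N → Model d) :
    subsetMean S (fun s => ‖(1 / (S : ℝ)) • ∑ i ∈ s, v i‖ ^ 2)
      ≤ 3 * ((1 / (N : ℝ)) * ∑ i, ‖v i - G i‖ ^ 2)
        + 3 * (((N : ℝ) - S) / (S * (N - 1)) * ((1 / (N : ℝ)) * ∑ i, ‖G i‖ ^ 2))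
        + 3 * ‖(1 / (N : ℝ)) • ∑ i, G i‖ ^ 2 := by
  have hSr : (S : ℝ) ≠ 0 := by positivity
  have hNr : (N : ℝ) ≠ 0 := by exact_mod_cast (hS0.trans_le hS).ne'
  set Gm := (1 / (N : ℝ)) • ∑ i, G i with hGm
  have hsum : ∑ i, (G i - Gm) = 0 := by
    rw [Finset.sum_sub_distrib, Finset.sum_const, Finset.card_univ, Fintype.card_fin,
      ← Nat.cast_smul_eq_nsmul ℝ, hGm, smul_smul, mul_one_div_cancel hNr, one_smul, sub_self]
  have hvar : ∑ i, ‖G i - Gm‖ ^ 2 ≤ ∑ i, ‖G i‖ ^ 2 := by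
    have h1 : ∀ i, ‖G i - Gm‖ ^ 2 = ‖G i‖ ^ 2 - ‖Gm‖ ^ 2 - 2 * inner ℝ (G i - Gm) Gm := by
      intro i
      rw [norm_sub_sq_real, inner_sub_left, real_inner_self_eq_norm_sq]; ring
    rw [Finset.sum_congr rfl fun i _ => h1 i, Finset.sum_sub_distrib, ← Finset.mul_sum,
      ← sum_inner, hsum, inner_zero_left, mul_zero, sub_zero]
    exact Finset.sum_le_sum fun i _ => sub_le_self _ (sq_nonneg _)
  have hpt : ∀ s : Finset (Fin N), s.card = S → ‖(1 / (S : ℝ)) • ∑ i ∈ s, v i‖ ^ 2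
      ≤ (3 * ((1 / (S : ℝ)) * ∑ i ∈ s, ‖v i - G i‖ ^ 2)
        + 3 * ‖(1 / (S : ℝ)) • ∑ i ∈ s, (G i - Gm)‖ ^ 2) + 3 * ‖Gm‖ ^ 2 := by
    intro s hs
    -- Split into the error of the directions, the sampling fluctuation of the exact gradients, and
    -- their mean; only the middle part uses the variance formula.
    have e : (1 / (S : ℝ)) • ∑ i ∈ s, v i = (1 / (S : ℝ)) • ∑ i ∈ s, (v i - G i)
        + (1 / (S : ℝ)) • ∑ i ∈ s, (G i - Gm) + Gm := by
      rw [← smul_add, ← Finset.sum_add_distrib]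
      simp only [sub_add_sub_cancel, Finset.sum_sub_distrib, Finset.sum_const, hs, smul_sub]
      rw [← Nat.cast_smul_eq_nsmul ℝ, smul_smul, one_div_mul_cancel hSr, one_smul, sub_add_cancel]
    rw [e]
    refine (norm_add_three_sq_le _ _ _).trans ?_
    have := norm_mean_sq_le s hs fun i => v i - G i
    linarith
  refine (subsetMean_mono hpt).trans ?_
  rw [subsetMean_add, subsetMean_add, subsetMean_const_mul S 3, subsetMean_const_mul S 3,
    subsetMean_const hS, subsetMean_mean hS0 hS, subsetMean_norm_sq hS0 hS _ hsum]
  have := (sampling_factor hS0 hS).1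
  gcongr

/-- Sampling is unbiased, so the cross term involves the mean over all clients and randomness
survives only at order `tau²`. -/
theorem subsetMean_norm_sub_sq {S : ℕ} (hS0 : 0 < S) (hS : S ≤ N) (tau : ℝ) (v : Fin N → Model d)
    (x : Model d) :
    subsetMean S (fun s => ‖x - tau • (1 / (S : ℝ)) • ∑ i ∈ s, v i‖ ^ 2)
      = ‖x‖ ^ 2 - 2 * tau * inner ℝ ((1 / (N : ℝ)) • ∑ i, v i) x
        + tau ^ 2 * subsetMean S (fun s => ‖(1 / (S : ℝ)) • ∑ i ∈ s, v i‖ ^ 2) := by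
  have h : ∀ s : Finset (Fin N), ‖x - tau • (1 / (S : ℝ)) • ∑ i ∈ s, v i‖ ^ 2
      = (‖x‖ ^ 2 + (-(2 * tau)) * ((1 / (S : ℝ)) * ∑ i ∈ s, inner ℝ (v i) x))
        + tau ^ 2 * ‖(1 / (S : ℝ)) • ∑ i ∈ s, v i‖ ^ 2 := by
    intro s
    rw [norm_sub_sq_real, norm_smul, mul_pow, Real.norm_eq_abs, sq_abs, real_inner_comm,
      inner_smul_left, inner_smul_left, sum_inner]
    simp only [conj_trivial]
    ring
  simp only [h]
  rw [subsetMean_add, subsetMean_add, subsetMean_const hS, subsetMean_const_mul S (-(2 * tau)),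
    subsetMean_const_mul S (tau ^ 2), subsetMean_mean hS0 hS, inner_smul_left, sum_inner]
  simp only [conj_trivial]
  ring

/-- The next global model if the clients in `s` are sampled. -/
def nextModel (R S : ℕ) (lam beta eta : ℝ) (θ : Fin N → ℕ → Model d) (w : Model d)
    (s : Finset (Fin N)) : Model d :=
  (1 - beta) • w + (beta / (S : ℝ)) • ∑ i ∈ s, localModel lam eta (θ i) w R

/-- The relaxation `beta` and the `R` local steps merge into one step of length `eta * beta * R`. -/
theorem nextModel_eq {R S : ℕ} (hR : 0 < R) (hS : 0 < S) (θ : Fin N → ℕ → Model d) (w : Model d)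
    {s : Finset (Fin N)} (hs : s.card = S) :
    nextModel R S lam beta eta θ w s
      = w - (eta * beta * R) • (1 / (S : ℝ)) • ∑ i ∈ s, localDir lam eta (θ i) w R := by
  have hSr : (S : ℝ) ≠ 0 := by positivity
  simp only [nextModel, localModel_eq_localDir hR, Finset.sum_sub_distrib, Finset.sum_const, hs,
    ← Finset.smul_sum, smul_sub]
  rw [← Nat.cast_smul_eq_nsmul ℝ, smul_smul, smul_smul, smul_smul, div_mul_cancel₀ _ hSr,
    show beta / (S : ℝ) * (eta * R) = eta * beta * R * (1 / S) by ring]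
  module

/-- One round of the algorithm, averaged over the sampled clients. -/
theorem subsetMean_round_le {R S : ℕ} (hR : 0 < R) (hS0 : 0 < S) (hS : S ≤ N) (hlam : 0 < lam)
    (hmu : 0 < mu) (hb : 1 ≤ beta) (hf : ∀ i, StronglyConvex mu (f i)) (heta : 0 < eta)
    (ht : eta * beta * R ≤ etaHat lam mu beta) (θ : Fin N → ℕ → Model d) (w : Model d) :
    subsetMean S (fun s => ‖nextModel R S lam beta eta θ w s - wStar lam f‖ ^ 2)
      ≤ (1 - eta * beta * R * muF lam mu / 2) * ‖w - wStar lam f‖ ^ 2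
        - eta * beta * R / 2 * (globalObj lam f w - globalObj lam f (wStar lam f))
        + ((eta * beta * R) ^ 2 * (12 * (((N : ℝ) / S - 1) / N) * sigmaSq lam f)
          + (eta * beta * R) ^ 3 * (24 * (lam / muF lam mu * lam / beta ^ 2) * sigmaSq lam f))
        + 7 * (eta * beta * R) / muF lam mu * lam ^ 2
          * ((1 / (N : ℝ)) * ∑ i, localErr lam eta (f i) (θ i) w R) := by
  have hN : 0 < N := hS0.trans_le hS
  have hNr : (N : ℝ) ≠ 0 := by positivity
  have hb0 : 0 < beta := by linarith
  have hRr : (0 : ℝ) < R := by positivity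
  have hm := muF_pos hlam hmu
  set m := muF lam mu with hmdef
  set tau := eta * beta * R with htau
  have ht0 : 0 < tau := by positivity
  obtain ⟨h18, h768⟩ := step_bounds hlam hmu hb ht ht0.le
  rw [← hmdef] at h768
  set wS := wStar lam f with hwS
  set v : Fin N → Model d := fun i => localDir lam eta (θ i) w R with hv
  set G : Fin N → Model d := fun i => moreauGrad lam (f i) w with hG
  set q := (eta * R * lam) ^ 2 with hq
  -- The drift is governed by the local length `eta * R`, smaller than `tau` by the factor `beta`;
  -- hence the gain from large `beta` in the drift term.
  have hp : eta * R * lam = lam * tau / beta := by rw [htau]; field_simp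
  have hp0 : 0 ≤ eta * R * lam := by positivity
  have hp18 : 18 * (eta * R * lam) ≤ 1 := by
    rw [hp, ← mul_div_assoc, ← mul_assoc]
    exact (div_le_self (by positivity) hb).trans h18
  have h1 : eta * lam ≤ 1 := by
    have hR1 : (1 : ℝ) ≤ R := by exact_mod_cast hR
    have : eta * 1 * lam ≤ eta * R * lam := by gcongr
    linarith
  have hq324 : 324 * q ≤ 1 := by nlinarith
  have hqL : 32 * q * lam ≤ m / 4 := by
    rw [← hp] at h768
    have h2 : 768 * lam * (eta * R * lam) ≤ m := by
      have : 768 * (lam / m) * (eta * R * lam) = 768 * lam * (eta * R * lam) / m := by ring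
      rwa [this, div_le_one hm] at h768
    have h3 : 32 * q * lam = (eta * R * lam) * (32 * lam * (eta * R * lam)) := by rw [hq]; ring
    have h4 : 32 * lam * (eta * R * lam) ≤ m / 4 := by nlinarith
    rw [h3]
    calc _ ≤ 1 * (m / 4) := by
          apply mul_le_mul _ h4 (by positivity) zero_le_one
          linarith
      _ = _ := one_mul _
  have hrw : subsetMean S (fun s => ‖nextModel R S lam beta eta θ w s - wS‖ ^ 2)
      = subsetMean S (fun s => ‖(w - wS) - tau • (1 / (S : ℝ)) • ∑ i ∈ s, v i‖ ^ 2) :=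
    subsetMean_congr fun s hs => by rw [nextModel_eq hR hS0 θ w hs, sub_right_comm]
  rw [hrw, subsetMean_norm_sub_sq hS0 hS]
  have hsec := subsetMean_norm_mean_sq_le hS0 hS v G
  set Φ := globalObj lam f w - globalObj lam f wS with hΦ
  have hΦ0 : 0 ≤ Φ := sub_nonneg.2 (globalObj_wStar_le hN hlam hmu hf w)
  obtain ⟨hz0, hz1, hz2⟩ := sampling_factor (N := N) hS0 hS
  set z := ((N : ℝ) - S) / (S * (N - 1)) with hz
  set M := (1 / (N : ℝ)) * ∑ i, ‖G i‖ ^ 2 with hM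
  set D := (1 / (N : ℝ)) * ∑ i, ‖v i - G i‖ ^ 2 with hD
  set e := lam ^ 2 * ((1 / (N : ℝ)) * ∑ i, localErr lam eta (f i) (θ i) w R) with he
  have he0 : 0 ≤ e := by
    have : ∀ i, 0 ≤ localErr lam eta (f i) (θ i) w R := fun i => localErr_nonneg _ _ _ _ _ _
    have := Finset.sum_nonneg fun i (_ : i ∈ Finset.univ) => this i
    positivity
  have hDle : D ≤ (2 + 4 * q) * e + 4 * q * M := by
    have : (2 + 4 * q) * e + 4 * q * M
        = (1 / (N : ℝ)) * ∑ i, ((2 + 4 * q) * lam ^ 2 * localErr lam eta (f i) (θ i) w R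
          + 4 * q * ‖G i‖ ^ 2) := by
      rw [Finset.sum_add_distrib, ← Finset.mul_sum, ← Finset.mul_sum]; ring
    rw [this]
    refine mul_le_mul_of_nonneg_left (Finset.sum_le_sum fun i _ => ?_) (by positivity)
    exact norm_localDir_sub_sq_le hlam hmu (hf i) heta.le h1 hR (θ i) w
  have hMle : M ≤ 4 * lam * Φ + 2 * sigmaSq lam f := mean_norm_moreauGrad_sq_le hN hlam hmu hf w
  have hGle : ‖(1 / (N : ℝ)) • ∑ i, G i‖ ^ 2 ≤ 2 * lam * Φ := norm_globalGrad_sq_le hN hlam hmu hf w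
  have hsig := sigmaSq_nonneg lam f
  have hscal := round_scalar (X := ‖w - wS‖ ^ 2) hlam hm (muF_le hlam hmu) ht0 h18 (sq_nonneg _)
    hqL hq324 hΦ0 hsig he0 hz0 hz1 hMle le_rfl hDle hGle
  -- Strong convexity between `w` and `w*` provides `-Φ - m / 2 * ‖w - w*‖²`; half of the quadratic
  -- term is spent on the error of the direction, which leaves the contraction `tau * m / 2`.
  have hinner : -(2 * tau * inner ℝ ((1 / (N : ℝ)) • ∑ i, v i) (w - wS))
      ≤ - 2 * tau * Φ - tau * m / 2 * ‖w - wS‖ ^ 2 + 2 * tau / m * D := by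
    set gb := (1 / (N : ℝ)) • ∑ i, v i with hgb
    set Gb := (1 / (N : ℝ)) • ∑ i, G i with hGb
    have hsc := (stronglyConvex_globalObj hN hlam hmu hf).2 wS w
    rw [(hasGradientAt_globalObj hlam hmu hf w).gradient] at hsc
    have hGb' : globalGrad lam f w = Gb := rfl
    rw [hGb', ← neg_sub w wS, inner_neg_right, norm_neg] at hsc
    have hdiff : ‖gb - Gb‖ ^ 2 ≤ D := by
      rw [hgb, hGb, ← smul_sub, ← Finset.sum_sub_distrib]
      exact norm_mean_sq_le Finset.univ (by simp) fun i => v i - G i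
    have hyoung : -(inner ℝ (gb - Gb) (w - wS)) ≤ 1 / m * D + m / 4 * ‖w - wS‖ ^ 2 := by
      have h2 := neg_le_of_abs_le (abs_real_inner_le_norm (gb - Gb) (w - wS))
      have h3 : ‖gb - Gb‖ * ‖w - wS‖ ≤ 1 / m * ‖gb - Gb‖ ^ 2 + m / 4 * ‖w - wS‖ ^ 2 := by
        have : 1 / m * ‖gb - Gb‖ ^ 2 + m / 4 * ‖w - wS‖ ^ 2 - ‖gb - Gb‖ * ‖w - wS‖
            = 1 / m * (‖gb - Gb‖ - m / 2 * ‖w - wS‖) ^ 2 := by field_simp; ring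
        have h4 : 0 ≤ 1 / m * (‖gb - Gb‖ - m / 2 * ‖w - wS‖) ^ 2 := by positivity
        linarith
      have h5 : 1 / m * ‖gb - Gb‖ ^ 2 ≤ 1 / m * D := by gcongr
      linarith
    rw [inner_sub_left] at hyoung
    have hfin : -(inner ℝ gb (w - wS)) ≤ -Φ - m / 4 * ‖w - wS‖ ^ 2 + 1 / m * D := by
      linarith
    have := mul_le_mul_of_nonneg_left hfin (show 0 ≤ 2 * tau by positivity)
    calc _ = 2 * tau * -(inner ℝ gb (w - wS)) := by ring
      _ ≤ _ := this
      _ = _ := by ring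
  have hsec' := mul_le_mul_of_nonneg_left hsec (sq_nonneg tau)
  have hzs : 6 * tau ^ 2 * z * sigmaSq lam f
      ≤ tau ^ 2 * (12 * (((N : ℝ) / S - 1) / N) * sigmaSq lam f) := by
    calc _ ≤ 6 * tau ^ 2 * (2 * (((N : ℝ) / S - 1) / N)) * sigmaSq lam f := by gcongr
      _ = _ := by ring
  have hqs : 24 * (tau * q / m) * sigmaSq lam f
      = tau ^ 3 * (24 * (lam / m * lam / beta ^ 2) * sigmaSq lam f) := by
    rw [hq, hp]; field_simp
  have he' : 7 * tau / m * lam ^ 2 * ((1 / (N : ℝ)) * ∑ i, localErr lam eta (f i) (θ i) w R)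
      = 7 * tau / m * e := by rw [he]; ring
  rw [he']
  linarith

end Round

/-! ### The scalar recursion and the choice of the step size. -/

section Recursion

/-- Telescoping a contracting recursion with the weights `ρ^{-(t+1)}`. -/
theorem weighted_telescope {rho tau c : ℝ} (hrho : 0 < rho) {a Φ : ℕ → ℝ} {T : ℕ}
    (h : ∀ t < T, a (t + 1) ≤ rho * a t - tau / 2 * Φ t + c) :
    tau / 2 * ∑ t ∈ Finset.range T, (rho ^ (t + 1))⁻¹ * Φ t + (rho ^ T)⁻¹ * a T
      ≤ a 0 + c * ∑ t ∈ Finset.range T, (rho ^ (t + 1))⁻¹ := by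
  induction T with
  | zero => simp
  | succ T ih =>
    have h1 := ih fun t ht => h t (ht.trans (Nat.lt_succ_self T))
    rw [Finset.sum_range_succ, Finset.sum_range_succ]
    have h2 := mul_le_mul_of_nonneg_left (h T (Nat.lt_succ_self T))
      (show 0 ≤ (rho ^ (T + 1))⁻¹ by positivity)
    have h3 : (rho ^ (T + 1))⁻¹ * (rho * a T - tau / 2 * Φ T + c)
        = (rho ^ T)⁻¹ * a T - tau / 2 * ((rho ^ (T + 1))⁻¹ * Φ T) + c * (rho ^ (T + 1))⁻¹ := by
      rw [pow_succ]; field_simp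
    linarith

theorem sum_weights {rho : ℝ} (hrho : 0 < rho) (T : ℕ) :
    (1 - rho) * ∑ t ∈ Finset.range T, (rho ^ (t + 1))⁻¹ = (rho ^ T)⁻¹ - 1 := by
  induction T with
  | zero => simp
  | succ T ih =>
    rw [Finset.sum_range_succ, mul_add, ih, pow_succ]
    field_simp
    ring

/-- The consequences of the recursion for the weighted average and for the last iterate. -/
theorem weighted_bounds {m tau c : ℝ} (hm : 0 < m) (ht : 0 < tau) (hmt : tau * m ≤ 1)
    {a Φ : ℕ → ℝ} {T : ℕ} (hT : 2 ≤ tau * m * T)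
    (ha : ∀ t, 0 ≤ a t) (hΦ : ∀ t, 0 ≤ Φ t)
    (h : ∀ t < T, a (t + 1) ≤ (1 - tau * m / 2) * a t - tau / 2 * Φ t + c) :
    let A := ∑ t ∈ Finset.range T, ((1 - tau * m / 2) ^ (t + 1))⁻¹
    let b := 2 * m * a 0 * Real.exp (-(tau * m * T) / 2) + 2 * c / tau
    0 < A ∧ A⁻¹ * ∑ t ∈ Finset.range T, ((1 - tau * m / 2) ^ (t + 1))⁻¹ * Φ t ≤ b ∧
      a T ≤ 1 / m * b := by
  intro A b
  set rho := 1 - tau * m / 2 with hrho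
  have hr0 : 0 < rho := by rw [hrho]; linarith
  have htm : 0 < tau * m := by positivity
  have hr1 : rho ≤ 1 := by rw [hrho]; linarith
  have hexp : rho ^ T ≤ Real.exp (-(tau * m * T) / 2) := by
    have h1 : rho ≤ Real.exp (-(tau * m / 2)) := by
      have := Real.add_one_le_exp (-(tau * m / 2))
      rw [hrho]; linarith
    calc rho ^ T ≤ Real.exp (-(tau * m / 2)) ^ T := pow_le_pow_left₀ hr0.le h1 T
      _ = _ := by rw [← Real.exp_nat_mul]; congr 1; ring
  have hhalf : rho ^ T ≤ 1 / 2 := by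
    refine hexp.trans ?_
    have h1 : Real.exp (-(tau * m * T) / 2) ≤ Real.exp (-1) := Real.exp_le_exp.2 (by linarith)
    have h2 : Real.exp (-1) ≤ 1 / 2 := by
      rw [Real.exp_neg, one_div]
      exact inv_anti₀ two_pos (by have := Real.add_one_le_exp (1 : ℝ); linarith)
    exact h1.trans h2
  have hA : tau * m / 2 * A = (rho ^ T)⁻¹ - 1 := by
    rw [← sum_weights hr0 T]; simp only [A]; rw [hrho]; ring
  have hp : 0 < rho ^ T := by positivity
  -- This is what the lower bound on `T` is for: `ρ^{-T} - 1` is at least half of `ρ^{-T}`, so `A`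
  -- is comparable to `ρ^{-T} / (tau m)` from both sides.
  have hinv : 2 ≤ (rho ^ T)⁻¹ := by
    rw [le_inv_comm₀ two_pos hp]; simpa using hhalf
  have hApos : 0 < A := by
    by_contra hc
    have : tau * m / 2 * A ≤ 0 := mul_nonpos_of_nonneg_of_nonpos (by positivity) (not_lt.1 hc)
    linarith
  have hAge : (rho ^ T)⁻¹ ≤ tau * m * A := by linarith
  have hAle : tau * m / 2 * A ≤ (rho ^ T)⁻¹ := by linarith
  have htel := weighted_telescope (tau := tau) hr0 h
  have hsum : 0 ≤ ∑ t ∈ Finset.range T, (rho ^ (t + 1))⁻¹ * Φ t :=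
    Finset.sum_nonneg fun t _ => mul_nonneg (by positivity) (hΦ t)
  have hinit : a 0 ≤ tau / 2 * A * (2 * m * a 0 * Real.exp (-(tau * m * T) / 2)) := by
    have h1 : 1 ≤ tau * m * A * rho ^ T := by
      have := mul_le_mul_of_nonneg_right hAge hp.le
      rwa [inv_mul_cancel₀ hp.ne'] at this
    have h2 : tau * m * A * rho ^ T ≤ tau * m * A * Real.exp (-(tau * m * T) / 2) := by gcongr
    have := mul_le_mul_of_nonneg_right (h1.trans h2) (ha 0)
    linarith
  have hb : a 0 + c * A ≤ tau / 2 * A * b := by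
    have : tau / 2 * A * (2 * c / tau) = c * A := by field_simp
    simp only [b]
    rw [mul_add, this]
    linarith
  refine ⟨hApos, ?_, ?_⟩
  · rw [inv_mul_le_iff₀ hApos]
    have h1 : tau / 2 * ∑ t ∈ Finset.range T, (rho ^ (t + 1))⁻¹ * Φ t ≤ tau / 2 * (A * b) := by
      have h2 : 0 ≤ (rho ^ T)⁻¹ * a T := mul_nonneg (by positivity) (ha T)
      have h3 : tau / 2 * (A * b) = tau / 2 * A * b := by ring
      rw [h3]
      exact le_trans (by linarith) (htel.trans hb)
    exact le_of_mul_le_mul_left h1 (by positivity)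
  · have h1 : (rho ^ T)⁻¹ * a T ≤ tau / 2 * A * b := by
      have : 0 ≤ tau / 2 * ∑ t ∈ Finset.range T, (rho ^ (t + 1))⁻¹ * Φ t := by positivity
      exact le_trans (by linarith) (htel.trans hb)
    -- The last iterate carries the weight `ρ^{-T}`, as large as `tau m / 2` times the total weight,
    -- so the bound on the average also bounds `m * a T`.
    have h2 : tau * m / 2 * A * a T ≤ tau / 2 * A * b :=
      (mul_le_mul_of_nonneg_right hAle (ha T)).trans h1
    have h3 : tau / 2 * A * (m * a T) ≤ tau / 2 * A * b := by linarith
    rw [one_div, le_inv_mul_iff₀ hm]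
    exact le_of_mul_le_mul_left h3 (by positivity)

/-- The choice of the effective step size. -/
theorem exists_step_size {m h n1 n2 a0 : ℝ} {T : ℕ} (hm : 0 < m) (hh : 0 < h)
    (hT : 2 / (h * m) ≤ (T : ℝ)) (ha : 0 ≤ a0) (hn1 : 0 ≤ n1) (hn2 : 0 ≤ n2) :
    ∃ tau, 0 < tau ∧ tau ≤ h ∧ 2 ≤ tau * m * T ∧
      m * a0 * Real.exp (-(tau * m * T) / 2)
        + tau * m * T * n1 + (tau * m * T) ^ 2 * n2
        ≤ a0 * m * Real.exp (-(h * m * T) / 2) + 3 * (logFactor m a0 (n1 + n2) * n1)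
          + 5 * (logFactor m a0 (n1 + n2) ^ 2 * n2) := by
  have hhm : 0 < h * m := by positivity
  have hTp : (0 : ℝ) < T := lt_of_lt_of_le (by positivity) hT
  have hT2 : 2 ≤ h * m * T := by rw [div_le_iff₀ hhm] at hT; linarith
  set Λ := logFactor m a0 (n1 + n2) with hΛ
  have hΛ1 : 1 ≤ Λ := by rw [hΛ, logFactor]; linarith [le_max_left 0 (Real.log (m * a0 / (n1 + n2)))]
  -- Without noise the largest step is best.
  rcases (add_nonneg hn1 hn2).eq_or_lt with h0 | h0
  · have e1 : n1 = 0 := by linarith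
    have e2 : n2 = 0 := by linarith
    refine ⟨h, hh, le_rfl, hT2, ?_⟩
    simp only [e1, e2, mul_zero, add_zero]
    linarith
  -- If the cap binds, the noise at `tau = h` is at most `2 Λ n1 + 4 Λ² n2`. Otherwise `tau * m * T
  -- = 2 Λ` makes the exponential term at most `n1 + n2`, which raises the constants to `3` and `5`.
  rcases le_total (h * m * T) (2 * Λ) with h1 | h1
  · refine ⟨h, hh, le_rfl, hT2, ?_⟩
    have h2 : h * m * T * n1 ≤ 2 * Λ * n1 := by gcongr
    have h3 : (h * m * T) ^ 2 * n2 ≤ (2 * Λ) ^ 2 * n2 := by gcongr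
    have h4 : 0 ≤ Λ * n1 := by positivity
    have h5 : 0 ≤ Λ ^ 2 * n2 := by positivity
    nlinarith
  · refine ⟨2 * Λ / (m * T), by positivity, ?_, ?_, ?_⟩
    · rw [div_le_iff₀ (by positivity)]; linarith
    · have : 2 * Λ / (m * T) * m * T = 2 * Λ := by field_simp
      rw [this]; linarith
    · have e : 2 * Λ / (m * T) * m * T = 2 * Λ := by field_simp
      rw [e, show -(2 * Λ) / 2 = -Λ by ring]
      have h2 : m * a0 * Real.exp (-Λ) ≤ n1 + n2 := by
        rcases ha.eq_or_lt with h3 | h3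
        -- For `a0 = 0` the left side vanishes; the logarithm gives no information there.
        · rw [← h3]; simp; linarith
        · have h4 : Real.log (m * a0 / (n1 + n2)) ≤ Λ := by
            rw [hΛ, logFactor]
            linarith [le_max_right 0 (Real.log (m * a0 / (n1 + n2)))]
          have h5 : m * a0 / (n1 + n2) ≤ Real.exp Λ :=
            (Real.log_le_iff_le_exp (by positivity)).1 h4
          rw [Real.exp_neg, mul_inv_le_iff₀ (Real.exp_pos _)]
          rw [div_le_iff₀ h0] at h5
          linarith
      have h3 : n1 ≤ Λ * n1 := le_mul_of_one_le_left hn1 hΛ1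
      have h4 : n2 ≤ Λ ^ 2 * n2 := le_mul_of_one_le_left hn2 (one_le_pow₀ hΛ1)
      have h5 : 0 ≤ a0 * m * Real.exp (-(h * m * T) / 2) := by positivity
      nlinarith

end Recursion

/-! ### Mini-batch gradients as noisy gradients. -/

section MiniBatch

variable {d : ℕ}

/-- The second moment of the mean of `B` independent centred vectors. -/
theorem integral_norm_mean_sq {α : Type*} [MeasurableSpace α] {μ : Measure α}
    [IsProbabilityMeasure μ] {X : α → Model d} (hX : MemLp X 2 μ) (h0 : ∫ x, X x ∂μ = 0) {B : ℕ}
    (hB : 0 < B) :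
    Integrable (fun b : Fin B → α => ‖(1 / (B : ℝ)) • ∑ k, X (b k)‖ ^ 2) (Measure.pi fun _ => μ) ∧
    ∫ b : Fin B → α, ‖(1 / (B : ℝ)) • ∑ k, X (b k)‖ ^ 2 ∂(Measure.pi fun _ => μ)
      = (1 / (B : ℝ)) * ∫ x, ‖X x‖ ^ 2 ∂μ := by
  have hBr : (B : ℝ) ≠ 0 := by positivity
  have hXj : ∀ j, MemLp (fun x => X x j) 2 μ := fun j =>
    (EuclideanSpace.proj (𝕜 := ℝ) j : Model d →L[ℝ] ℝ).comp_memLp' hX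
  have h0j : ∀ j, ∫ x, X x j ∂μ = 0 := fun j => by
    have := (EuclideanSpace.proj (𝕜 := ℝ) j : Model d →L[ℝ] ℝ).integral_comp_comm
      (hX.integrable (by norm_num))
    rw [h0, map_zero] at this
    exact this
  have hev : ∀ k : Fin B, MeasurePreserving (Function.eval k) (Measure.pi fun _ : Fin B => μ) μ :=
    fun k => measurePreserving_eval (fun _ : Fin B => μ) k
  have hsum : ∀ j, MemLp (∑ k : Fin B, fun b : Fin B → α => X (b k) j) 2
      (Measure.pi fun _ : Fin B => μ) := fun j =>
    memLp_finsetSum' _ fun k _ => (hXj j).comp_measurePreserving (hev k)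
  -- The vector statement is proved coordinatewise, where variances of independent variables add.
  have hvar : ∀ j, ∫ b : Fin B → α, (∑ k, X (b k) j) ^ 2 ∂(Measure.pi fun _ => μ)
      = B * ∫ x, X x j ^ 2 ∂μ := by
    intro j
    have h1 := variance_sum_pi (μ := fun _ : Fin B => μ) (X := fun _ x => X x j) fun _ => hXj j
    have h2 : ∫ b, (∑ k : Fin B, fun b : Fin B → α => X (b k) j) b ∂(Measure.pi fun _ => μ) = 0 := by
      simp only [Finset.sum_apply]
      have h3 : ∀ k ∈ Finset.univ, Integrable (fun b : Fin B → α => X (b k) j)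
          (Measure.pi fun _ => μ) := fun k _ =>
        ((hXj j).comp_measurePreserving (hev k)).integrable (by norm_num)
      rw [integral_finsetSum _ h3]
      refine Finset.sum_eq_zero fun k _ => ?_
      rw [← h0j j]
      have h4 := (hXj j).aestronglyMeasurable
      rw [← (hev k).map_eq] at h4
      conv_rhs => rw [← (hev k).map_eq]
      rw [integral_map (hev k).measurable.aemeasurable h4]
    rw [variance_of_integral_eq_zero (hsum j).aestronglyMeasurable.aemeasurable h2,
      Finset.sum_congr rfl fun k _ => variance_of_integral_eq_zero
        (hXj j).aestronglyMeasurable.aemeasurable (h0j j)] at h1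
    simpa using h1
  have hn : ∀ b : Fin B → α, ‖(1 / (B : ℝ)) • ∑ k, X (b k)‖ ^ 2
      = (1 / (B : ℝ)) ^ 2 * ∑ j, (∑ k, X (b k) j) ^ 2 := by
    intro b
    rw [norm_smul, mul_pow, Real.norm_eq_abs, sq_abs, EuclideanSpace.real_norm_sq_eq]
    simp
  have hint : ∀ j ∈ Finset.univ, Integrable (fun b : Fin B → α => (∑ k, X (b k) j) ^ 2)
      (Measure.pi fun _ => μ) := fun j _ => by
    simpa using (hsum j).integrable_sq
  simp only [hn]
  refine ⟨(integrable_finsetSum _ hint).const_mul _, ?_⟩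
  rw [integral_const_mul, integral_finsetSum _ hint, Finset.sum_congr rfl fun j _ => hvar j,
    ← Finset.mul_sum, ← integral_finsetSum _ fun j _ => (hXj j).integrable_sq]
  simp only [EuclideanSpace.real_norm_sq_eq]
  field_simp

variable {N : ℕ} {Ξ : Fin N → Type*} [∀ i, MeasurableSpace (Ξ i)] {D : ∀ i, Measure (Ξ i)}
  {ℓ : ∀ i, Model d → Ξ i → ℝ}

theorem measurable_gradient (g : Model d → ℝ) : Measurable (gradient g) :=
  (InnerProductSpace.toDual ℝ (Model d)).symm.continuous.measurable.comp (measurable_fderiv ℝ g)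

/-- The deviation of the mini-batch gradient from the gradient of the expected loss. -/
def batchNoise (D : ∀ i, Measure (Ξ i)) (ℓ : ∀ i, Model d → Ξ i → ℝ) {B : ℕ} (i : Fin N)
    (θ : Model d) (b : Fin B → Ξ i) : Model d :=
  (1 / (B : ℝ)) • ∑ k, (sampleGrad ℓ i θ (b k) - gradient (expectedLoss D ℓ i) θ)

theorem measurable_batchNoise (h : IsStochasticLoss D ℓ) {B : ℕ} (i : Fin N) :
    Measurable fun p : Model d × (Fin B → Ξ i) => batchNoise D ℓ i p.1 p.2 := by
  unfold batchNoise
  have hk : ∀ k : Fin B, Measurable fun p : Model d × (Fin B → Ξ i) =>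
      sampleGrad ℓ i p.1 (p.2 k) - gradient (expectedLoss D ℓ i) p.1 := fun k => ?_
  · exact (Finset.measurable_fun_sum _ fun k _ => hk k).const_smul (1 / (B : ℝ))
  refine Measurable.sub ?_ ((measurable_gradient _).comp measurable_fst)
  exact (h.measurable_grad i).comp
    (measurable_fst.prodMk ((measurable_pi_apply k).comp measurable_snd))

/-- Stated with the lower integral, so that Tonelli's theorem can be applied at a random `θ` before
joint integrability is known. -/
theorem integral_batchNoise_sq_le [∀ i, IsProbabilityMeasure (D i)] (h : IsStochasticLoss D ℓ)
    {gam : ℝ} (hv : BoundedVariance D ℓ gam) {B : ℕ} (hB : 0 < B) (i : Fin N) (θ : Model d) :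
    ∫⁻ b : Fin B → Ξ i, ENNReal.ofReal (‖batchNoise D ℓ i θ b‖ ^ 2) ∂(Measure.pi fun _ => D i)
      ≤ ENNReal.ofReal (gam ^ 2 / B) := by
  have hm : Measurable fun ξ => sampleGrad ℓ i θ ξ - gradient (expectedLoss D ℓ i) θ :=
    ((h.measurable_grad i).comp measurable_prodMk_left).sub_const _
  have hX : MemLp (fun ξ => sampleGrad ℓ i θ ξ - gradient (expectedLoss D ℓ i) θ) 2 (D i) :=
    (memLp_two_iff_integrable_sq_norm hm.aestronglyMeasurable).2 (hv i θ).1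
  have h0 : ∫ ξ, (sampleGrad ℓ i θ ξ - gradient (expectedLoss D ℓ i) θ) ∂(D i) = 0 := by
    rw [integral_sub (h.integrable_grad i θ) (integrable_const _), h.unbiased]
    simp
  obtain ⟨h1, h2⟩ := integral_norm_mean_sq hX h0 hB
  unfold batchNoise
  rw [← ofReal_integral_eq_lintegral_ofReal h1 (Filter.Eventually.of_forall fun _ => by positivity)]
  refine ENNReal.ofReal_le_ofReal ?_
  rw [h2, one_div, inv_mul_eq_div]
  exact div_le_div_of_nonneg_right (hv i θ).2 (by positivity)

theorem gradient_batchObj (h : IsStochasticLoss D ℓ) (lam : ℝ) {B : ℕ} (i : Fin N) (w : Model d)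
    (b : Fin B → Ξ i) (θ : Model d) :
    gradient (batchObj ℓ lam i w b) θ
      = (1 / (B : ℝ)) • ∑ k, sampleGrad ℓ i θ (b k) + lam • (θ - w) :=
  (hasGradientAt_add (hasGradientAt_const_mul _ (hasGradientAt_sum _ fun k _ =>
    (h.differentiable i (b k) θ).hasGradientAt)) (hasGradientAt_sq_dist lam w θ)).gradient

/-- The optimality condition `∇f(prox w) = lam • (w - prox w)` cancels the deterministic part of the
mini-batch gradient. -/
theorem gradient_batchObj_prox (h : IsStochasticLoss D ℓ) {mu lam : ℝ} (hlam : 0 < lam)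
    (hmu : 0 < mu) {B : ℕ} (hB : 0 < B) (i : Fin N) (hf : StronglyConvex mu (expectedLoss D ℓ i))
    (w : Model d) (b : Fin B → Ξ i) :
    gradient (batchObj ℓ lam i w b) (prox lam (expectedLoss D ℓ i) w)
      = batchNoise D ℓ i (prox lam (expectedLoss D ℓ i) w) b := by
  have hBr : (B : ℝ) ≠ 0 := by positivity
  have e : (1 / (B : ℝ)) • ∑ _k : Fin B,
      gradient (expectedLoss D ℓ i) (prox lam (expectedLoss D ℓ i) w)
      = gradient (expectedLoss D ℓ i) (prox lam (expectedLoss D ℓ i) w) := by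
    rw [Finset.sum_const, Finset.card_univ, Fintype.card_fin, ← Nat.cast_smul_eq_nsmul ℝ,
      smul_smul, one_div_mul_cancel hBr, one_smul]
  rw [gradient_batchObj h, batchNoise, Finset.sum_sub_distrib, smul_sub (1 / (B : ℝ)), e, gradient_prox hlam.le hmu hf, moreauGrad]
  module

end MiniBatch

/-! ### Runs: adaptedness, and accuracy from strongly convex mini-batch objectives. -/

namespace Run

variable {d N : ℕ} {Ξ : Fin N → Type*} [∀ i, MeasurableSpace (Ξ i)]
  {D : ∀ i, Measure (Ξ i)} {ℓ : ∀ i, Model d → Ξ i → ℝ} {T R S B : ℕ}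
  {lam beta eta nu : ℝ} {w0 : Model d} {Ω : Type*} [mΩ : MeasurableSpace Ω] {P : Measure Ω}

theorem hist_mono (run : Run D ℓ T R S B lam beta eta nu w0 P) (t : ℕ) : Monotone (run.hist t) :=
  monotone_nat_of_le_succ (run.hist_local t)

theorem w_zero (run : Run D ℓ T R S B lam beta eta nu w0 P) (ω : Ω) : run.w 0 ω = w0 := rfl

theorem w_succ_eq_nextModel (run : Run D ℓ T R S B lam beta eta nu w0 P) (t : ℕ) (ω : Ω) :
    run.w (t + 1) ω
      = nextModel R S lam beta eta (fun i k => run.theta t i k ω) (run.w t ω) (run.sel t ω) := rfl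

theorem wLoc_succ (run : Run D ℓ T R S B lam beta eta nu w0 P) (t : ℕ) (i : Fin N) (r : ℕ) :
    run.wLoc t i (r + 1)
      = fun ω => run.wLoc t i r ω - (eta * lam) • (run.wLoc t i r ω - run.theta t i r ω) := rfl

/-- A sum over a random set is rewritten as a sum of indicators over all clients, from which
measurability and integrability can be read off. -/
theorem w_succ (run : Run D ℓ T R S B lam beta eta nu w0 P) (t : ℕ) :
    run.w (t + 1) = fun ω => (1 - beta) • run.w t ω + (beta / (S : ℝ)) •
      ∑ i, {ω | i ∈ run.sel t ω}.indicator (run.wLoc t i R) ω := by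
  funext ω
  rw [w_succ_eq_nextModel, nextModel]
  congr 2
  simp only [Set.indicator_apply, Set.mem_ofPred_eq, Finset.sum_ite_mem, Finset.univ_inter]
  rfl

theorem measurableSet_mem_sel (run : Run D ℓ T R S B lam beta eta nu w0 P) {t : ℕ} (ht : t < T)
    (i : Fin N) : MeasurableSet[run.hist (t + 1) 0] {ω | i ∈ run.sel t ω} :=
  run.sel_measurable t ht (show MeasurableSet[⊤] {s | i ∈ s} from trivial)

theorem measurable_wLoc_of_w (run : Run D ℓ T R S B lam beta eta nu w0 P) {t : ℕ}
    (hw : Measurable[run.hist t 0] (run.w t)) (ht : t < T) (i : Fin N) {r : ℕ} (hr : r ≤ R) :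
    Measurable[run.hist t r] (run.wLoc t i r) := by
  induction r with
  | zero => exact hw
  | succ r ih =>
    have h1 : Measurable[run.hist t (r + 1)] (run.wLoc t i r) :=
      (ih (by omega)).mono (run.hist_local t r) le_rfl
    have h2 := run.theta_measurable t i r (Or.inl ⟨ht, hr⟩)
    rw [wLoc_succ]
    exact h1.sub (Measurable.const_smul (h1.sub h2) (eta * lam))

theorem measurable_w (run : Run D ℓ T R S B lam beta eta nu w0 P) {t : ℕ} (ht : t ≤ T) :
    Measurable[run.hist t 0] (run.w t) := by
  induction t with
  | zero => exact measurable_const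
  | succ t ih =>
    have h0 := ih (by omega)
    have hle : run.hist t R ≤ run.hist (t + 1) 0 := run.hist_global t
    have h1 : Measurable[run.hist (t + 1) 0] (run.w t) :=
      h0.mono ((run.hist_mono t (Nat.zero_le R)).trans hle) le_rfl
    rw [w_succ]
    have h2 : ∀ i, Measurable[run.hist (t + 1) 0]
        ({ω | i ∈ run.sel t ω}.indicator (run.wLoc t i R)) := fun i => ?_
    · exact (h1.const_smul (1 - beta)).add
        (Measurable.const_smul (Finset.measurable_fun_sum _ fun i _ => h2 i) (beta / (S : ℝ)))
    exact ((run.measurable_wLoc_of_w h0 ht i le_rfl).mono hle le_rfl).indicator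
      (run.measurableSet_mem_sel ht i)

theorem measurable_wLoc (run : Run D ℓ T R S B lam beta eta nu w0 P) {t : ℕ} (ht : t < T)
    (i : Fin N) {r : ℕ} (hr : r ≤ R) : Measurable[run.hist t r] (run.wLoc t i r) :=
  run.measurable_wLoc_of_w (run.measurable_w ht.le) ht i hr

theorem measurable_wLoc_of_active (run : Run D ℓ T R S B lam beta eta nu w0 P) {t r : ℕ}
    (h : Active T R t r) (i : Fin N) : Measurable[run.hist t r] (run.wLoc t i r) := by
  rcases h with ⟨ht, hr⟩ | ⟨rfl, rfl⟩
  · exact run.measurable_wLoc ht i hr.le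
  · exact run.measurable_w le_rfl

/-- Strong convexity of the mini-batch objectives makes the personalized models accurate. -/
theorem isDeltaApprox_of_stronglyConvex [∀ i, IsProbabilityMeasure (D i)] [IsProbabilityMeasure P]
    (run : Run D ℓ T R S B lam beta eta nu w0 P) (h : IsStochasticLoss D ℓ) {mu gam delta m : ℝ}
    (hlam : 0 < lam) (hmu : 0 < mu) (hB : 0 < B)
    (hf : ∀ i, StronglyConvex mu (expectedLoss D ℓ i)) (hv : BoundedVariance D ℓ gam) (hm : 0 < m)
    (hbatch : ∀ (i : Fin N) (w : Model d) (batch : Fin B → Ξ i),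
      StronglyConvex m (batchObj ℓ lam i w batch))
    (hdelta : 2 / m ^ 2 * (gam ^ 2 / B + nu) ≤ delta ^ 2) : run.IsDeltaApprox delta := by
  intro t i r hact
  set p : Ω → Model d := fun ω => prox lam (expectedLoss D ℓ i) (run.wLoc t i r ω) with hp
  have hpm : Measurable[run.hist t r] p :=
    (continuous_prox hlam hmu (hf i)).measurable.comp (run.measurable_wLoc_of_active hact i)
  have hpm' : Measurable p := hpm.mono (run.hist_le t r) le_rfl
  have hbm : Measurable (run.batch t i r) :=
    (run.batch_measurable t i r hact).mono (run.hist_le _ _) le_rfl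
  have hthm : Measurable (run.theta t i r) :=
    (run.theta_measurable t i r hact).mono (run.hist_le _ _) le_rfl
  -- The exact proximal point is known before the batch is drawn, so their joint law is a product
  -- and the noise bound at fixed `θ` can be integrated. The computed model depends on the batch and
  -- would not do.
  have hindep : IndepFun p (run.batch t i r) P := by
    rw [IndepFun_iff_Indep]
    exact (indep_of_indep_of_le_right (run.batch_fresh t i r hact) hpm.comap_le).symm
  have hlaw : P.map (fun ω => (p ω, run.batch t i r ω))
      = (P.map p).prod (Measure.pi fun _ => D i) := by
    rw [(indepFun_iff_map_prod_eq_prod_map_map hpm'.aemeasurable hbm.aemeasurable).1 hindep,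
      run.batch_law t i r hact]
  have hψ : Measurable fun q : Model d × (Fin B → Ξ i) =>
      ENNReal.ofReal (‖batchNoise D ℓ i q.1 q.2‖ ^ 2) :=
    ((measurable_batchNoise h i).norm.pow_const 2).ennreal_ofReal
  have hnoise : ∫⁻ ω, ENNReal.ofReal (‖batchNoise D ℓ i (p ω) (run.batch t i r ω)‖ ^ 2) ∂P
      ≤ ENNReal.ofReal (gam ^ 2 / B) := by
    have hmap : IsProbabilityMeasure (P.map p) := Measure.isProbabilityMeasure_map hpm'.aemeasurable
    rw [← lintegral_map hψ (hpm'.prodMk hbm), hlaw, lintegral_prod _ hψ.aemeasurable]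
    refine (lintegral_mono fun θ => integral_batchNoise_sq_le h hv hB i θ).trans ?_
    simp
  have hnm : Measurable fun ω => ‖batchNoise D ℓ i (p ω) (run.batch t i r ω)‖ ^ 2 :=
    ((measurable_batchNoise h i).comp (hpm'.prodMk hbm)).norm.pow_const 2
  have hnint : Integrable (fun ω => ‖batchNoise D ℓ i (p ω) (run.batch t i r ω)‖ ^ 2) P := by
    refine ⟨hnm.aestronglyMeasurable, ?_⟩
    rw [hasFiniteIntegral_iff_ofReal (Filter.Eventually.of_forall fun _ => by positivity)]
    exact hnoise.trans_lt ENNReal.ofReal_lt_top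
  have hnle : ∫ ω, ‖batchNoise D ℓ i (p ω) (run.batch t i r ω)‖ ^ 2 ∂P ≤ gam ^ 2 / B := by
    rw [integral_eq_lintegral_of_nonneg_ae (Filter.Eventually.of_forall fun _ => by positivity)
      hnm.aestronglyMeasurable]
    exact ENNReal.toReal_le_of_le_ofReal (by positivity) hnoise
  have hpt : ∀ ω, ‖run.theta t i r ω - p ω‖ ^ 2
      ≤ 2 / m ^ 2 * (‖batchNoise D ℓ i (p ω) (run.batch t i r ω)‖ ^ 2 + nu) := by
    intro ω
    have h1 := (hbatch i (run.wLoc t i r ω) (run.batch t i r ω)).mul_norm_le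
      (run.theta t i r ω) (p ω)
    have h2 : ‖gradient (batchObj ℓ lam i (run.wLoc t i r ω) (run.batch t i r ω))
      (run.theta t i r ω)‖ ^ 2 ≤ nu := run.theta_accuracy t i r hact ω
    rw [hp] at h1
    simp only at h1
    rw [gradient_batchObj_prox h hlam hmu hB i (hf i)] at h1
    have h3 := h1.trans (norm_sub_le _ _)
    -- From `m ‖θ - p‖ ≤ ‖∇h̃(θ)‖ + ‖∇h̃(p)‖` and `(a + b)² ≤ 2 a² + 2 b²`; this is the factor `2 /
    -- m²`.
    have h4 := pow_le_pow_left₀ (by positivity) h3 2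
    rw [div_mul_eq_mul_div, le_div_iff₀ (by positivity)]
    nlinarith [sq_nonneg (‖gradient (batchObj ℓ lam i (run.wLoc t i r ω) (run.batch t i r ω))
      (run.theta t i r ω)‖ - ‖batchNoise D ℓ i (p ω) (run.batch t i r ω)‖)]
  have hbint : Integrable (fun ω => 2 / m ^ 2 *
      (‖batchNoise D ℓ i (p ω) (run.batch t i r ω)‖ ^ 2 + nu)) P :=
    (hnint.add (integrable_const nu)).const_mul _
  have hint : Integrable (fun ω => ‖run.theta t i r ω - p ω‖ ^ 2) P := by
    refine hbint.mono' ((hthm.sub hpm').norm.pow_const 2).aestronglyMeasurable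
      (Filter.Eventually.of_forall fun ω => ?_)
    rw [Real.norm_of_nonneg (by positivity)]
    exact hpt ω
  refine ⟨hint, (integral_mono hint hbint hpt).trans ?_⟩
  rw [integral_const_mul, integral_add hnint (integrable_const nu)]
  refine le_trans ?_ hdelta
  simp only [integral_const, probReal_univ, one_smul]
  gcongr

end Run

/-! ### Square integrability, and the round inequality in expectation. -/

theorem memLp_prox {d : ℕ} {lam mu : ℝ} (hlam : 0 < lam) (hmu : 0 < mu) {f : Model d → ℝ}
    (hf : StronglyConvex mu f) {Ω : Type*} [MeasurableSpace Ω] {P : Measure Ω} [IsFiniteMeasure P]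
    {X : Ω → Model d} (hX : MemLp X 2 P) : MemLp (fun ω => prox lam f (X ω)) 2 P := by
  have h1 : MemLp (fun ω => prox lam f (X ω) - prox lam f 0) 2 P := by
    refine hX.of_le (((continuous_prox hlam hmu hf).comp_aestronglyMeasurable
      hX.aestronglyMeasurable).sub aestronglyMeasurable_const)
      (Filter.Eventually.of_forall fun ω => ?_)
    simpa using norm_prox_sub_le hlam hmu hf (X ω) 0
  exact (h1.add (memLp_const (prox lam f 0))).ae_eq (Filter.Eventually.of_forall fun ω => by simp)

namespace Run

variable {d N : ℕ} {Ξ : Fin N → Type*} [∀ i, MeasurableSpace (Ξ i)]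
  {D : ∀ i, Measure (Ξ i)} {ℓ : ∀ i, Model d → Ξ i → ℝ} {T R S B : ℕ}
  {lam mu beta eta nu delta : ℝ} {w0 : Model d} {Ω : Type*} [mΩ : MeasurableSpace Ω]
  {P : Measure Ω}

theorem memLp_theta_sub (run : Run D ℓ T R S B lam beta eta nu w0 P) (hlam : 0 < lam)
    (hmu : 0 < mu) (hf : ∀ i, StronglyConvex mu (expectedLoss D ℓ i))
    (hd : run.IsDeltaApprox delta) {t r : ℕ} (h : Active T R t r) (i : Fin N) :
    MemLp (fun ω => run.theta t i r ω - prox lam (expectedLoss D ℓ i) (run.wLoc t i r ω)) 2 P := by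
  have h1 : Measurable (run.theta t i r) :=
    (run.theta_measurable t i r h).mono (run.hist_le _ _) le_rfl
  have h2 : Measurable (run.wLoc t i r) :=
    (run.measurable_wLoc_of_active h i).mono (run.hist_le _ _) le_rfl
  have h3 : Measurable fun ω =>
      run.theta t i r ω - prox lam (expectedLoss D ℓ i) (run.wLoc t i r ω) :=
    h1.sub ((continuous_prox hlam hmu (hf i)).measurable.comp h2)
  exact (memLp_two_iff_integrable_sq_norm h3.aestronglyMeasurable).2 (hd t i r h).1

theorem memLp_wLoc_of_w [IsProbabilityMeasure P]
    (run : Run D ℓ T R S B lam beta eta nu w0 P) (hlam : 0 < lam)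
    (hmu : 0 < mu) (hf : ∀ i, StronglyConvex mu (expectedLoss D ℓ i))
    (hd : run.IsDeltaApprox delta) {t : ℕ} (ht : t < T) (hw : MemLp (run.w t) 2 P) (i : Fin N)
    {r : ℕ} (hr : r ≤ R) : MemLp (run.wLoc t i r) 2 P := by
  induction r with
  | zero => exact hw
  | succ r ih =>
    have h1 := ih (by omega)
    have h2 : MemLp (run.theta t i r) 2 P := by
      have := (run.memLp_theta_sub hlam hmu hf hd (Or.inl ⟨ht, hr⟩) i).add
        (memLp_prox hlam hmu (hf i) h1)
      refine this.ae_eq (Filter.Eventually.of_forall fun ω => ?_)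
      simp
    rw [wLoc_succ]
    exact h1.sub ((h1.sub h2).const_smul (eta * lam))

/-- Ensures that the expectations are genuine rather than the default value `0`. The induction works
because `prox` is Lipschitz and each computed model differs from it by a square-integrable error. -/
theorem memLp_w [IsProbabilityMeasure P]
    (run : Run D ℓ T R S B lam beta eta nu w0 P) (hlam : 0 < lam)
    (hmu : 0 < mu) (hf : ∀ i, StronglyConvex mu (expectedLoss D ℓ i))
    (hd : run.IsDeltaApprox delta) {t : ℕ} (ht : t ≤ T) : MemLp (run.w t) 2 P := by
  induction t with
  | zero => exact memLp_const w0
  | succ t ih =>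
    have h0 := ih (by omega)
    rw [w_succ]
    have h2 : ∀ i, MemLp ({ω | i ∈ run.sel t ω}.indicator (run.wLoc t i R)) 2 P := fun i =>
      (run.memLp_wLoc_of_w hlam hmu hf hd ht h0 i le_rfl).indicator
        (run.hist_le _ _ _ (run.measurableSet_mem_sel ht i))
    exact (h0.const_smul (1 - beta)).add
      ((memLp_finsetSum _ fun i _ => h2 i).const_smul (beta / (S : ℝ)))

theorem measurableSet_sel_eq (run : Run D ℓ T R S B lam beta eta nu w0 P) {t : ℕ} (ht : t < T)
    (s : Finset (Fin N)) : MeasurableSet {ω | run.sel t ω = s} :=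
  run.hist_le _ _ _ (run.sel_measurable t ht (show MeasurableSet[⊤] {s' | s' = s} from trivial))

/-- Almost surely `S` clients are sampled. -/
theorem measureReal_sel_eq [IsProbabilityMeasure P]
    (run : Run D ℓ T R S B lam beta eta nu w0 P) (hS : S ≤ N) {t : ℕ}
    (ht : t < T) (s : Finset (Fin N)) :
    P.real {ω | run.sel t ω = s} = if s.card = S then (N.choose S : ℝ)⁻¹ else 0 := by
  have hcard : ∀ s : Finset (Fin N), s.card = S →
      P.real {ω | run.sel t ω = s} = (N.choose S : ℝ)⁻¹ := by
    intro s hs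
    rw [measureReal_def, run.sel_uniform t ht s hs]
    simp
  split_ifs with hs
  · exact hcard s hs
  have hC : (N.choose S : ℝ) ≠ 0 := by exact_mod_cast (Nat.choose_pos hS).ne'
  have hsum : ∑ s : Finset (Fin N), P.real {ω | run.sel t ω = s} = 1 := by
    rw [← probReal_univ (μ := P), ← measureReal_biUnion_finset]
    · congr 1
      ext ω
      simp
    · intro a _ b _ hab
      refine Set.disjoint_left.2 fun ω h1 h2 => hab ?_
      exact (show run.sel t ω = a from h1).symm.trans h2
    · exact fun s _ => run.measurableSet_sel_eq ht s
  -- The sets of size `S` already have total probability one, so every other set has probability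
  -- zero.
  rw [← Finset.sum_filter_add_sum_filter_not _ (fun s : Finset (Fin N) => s.card = S),
    Finset.sum_congr rfl (fun s hs => hcard s (Finset.mem_filter.1 hs).2), Finset.sum_const,
    nsmul_eq_mul] at hsum
  have hcnt : (Finset.univ.filter fun s : Finset (Fin N) => s.card = S).card = N.choose S := by
    rw [show (Finset.univ.filter fun s : Finset (Fin N) => s.card = S)
        = Finset.powersetCard S Finset.univ by ext; simp [Finset.mem_powersetCard],
      Finset.card_powersetCard, Finset.card_univ, Fintype.card_fin]
  rw [hcnt, mul_inv_cancel₀ hC, add_eq_left] at hsum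
  exact (Finset.sum_eq_zero_iff_of_nonneg fun _ _ => measureReal_nonneg).1 hsum s
    (Finset.mem_filter.2 ⟨Finset.mem_univ _, hs⟩)

/-- Sampling is independent of the local updates of the round. -/
theorem integral_sel [IsProbabilityMeasure P]
    (run : Run D ℓ T R S B lam beta eta nu w0 P) (hS : S ≤ N) {t : ℕ}
    (ht : t < T) {h : Finset (Fin N) → Ω → ℝ} (hm : ∀ s, Measurable[run.hist t R] (h s))
    (hi : ∀ s, Integrable (h s) P) :
    ∫ ω, h (run.sel t ω) ω ∂P = ∫ ω, subsetMean S (fun s => h s ω) ∂P := by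
  -- Decompose by the value of the sampled set; each indicator is independent of `h s`, which is
  -- known before the draw.
  have e1 : ∀ ω, h (run.sel t ω) ω = ∑ s, {ω | run.sel t ω = s}.indicator (h s) ω := by
    intro ω
    simp [Set.indicator_apply]
  have hind : ∀ s, Integrable ({ω | run.sel t ω = s}.indicator (h s)) P := fun s =>
    (hi s).indicator (run.measurableSet_sel_eq ht s)
  have hprod : ∀ s, ∫ ω, {ω | run.sel t ω = s}.indicator (h s) ω ∂P
      = P.real {ω | run.sel t ω = s} * ∫ ω, h s ω ∂P := by
    intro s
    have hA := run.measurableSet_sel_eq ht s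
    set A := {ω | run.sel t ω = s} with hAdef
    have hAm : Measurable[MeasurableSpace.comap (run.sel t) ⊤] (A.indicator fun _ => (1 : ℝ)) :=
      measurable_const.indicator ⟨{s' | s' = s}, trivial, rfl⟩
    have hindep : IndepFun (A.indicator fun _ => (1 : ℝ)) (h s) P := by
      rw [IndepFun_iff_Indep]
      exact indep_of_indep_of_le_left (indep_of_indep_of_le_right (run.sel_indep t ht)
        (hm s).comap_le) hAm.comap_le
    have h2 := hindep.integral_mul_eq_mul_integral
      (measurable_const.indicator hA).aestronglyMeasurable (hi s).aestronglyMeasurable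
    rw [integral_indicator_const _ hA, smul_eq_mul, mul_one] at h2
    rw [← h2]
    congr 1
    funext ω
    by_cases hω : ω ∈ A <;> simp [hω]
  simp only [e1]
  rw [integral_finsetSum _ fun s _ => hind s]
  simp only [subsetMean]
  rw [integral_const_mul, integral_finsetSum _ fun s _ => hi s, Finset.mul_sum,
    ← Finset.sum_subset (Finset.subset_univ (Finset.powersetCard S Finset.univ))]
  · refine Finset.sum_congr rfl fun s hs => ?_
    rw [hprod, run.measureReal_sel_eq hS ht, if_pos (Finset.mem_powersetCard.1 hs).2]
  · intro s _ hs
    rw [hprod, run.measureReal_sel_eq hS ht, if_neg, zero_mul]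
    simpa [Finset.mem_powersetCard] using hs

theorem integrable_globalObj_sub [IsProbabilityMeasure P] (hN : 0 < N) (hlam : 0 < lam) (hmu : 0 < mu)
    {f : Fin N → Model d → ℝ} (hf : ∀ i, StronglyConvex mu (f i)) {X : Ω → Model d}
    (hX : MemLp X 2 P) :
    Integrable (fun ω => globalObj lam f (X ω) - globalObj lam f (wStar lam f)) P := by
  have hc : Continuous (globalObj lam f) :=
    (stronglyConvex_globalObj hN hlam hmu hf).1.continuous
  have h1 : Integrable (fun ω => lam / 2 * ‖X ω - wStar lam f‖ ^ 2) P :=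
    ((hX.sub (memLp_const (wStar lam f))).integrable_norm_pow (by norm_num)).const_mul _
  refine h1.mono' ((hc.comp_aestronglyMeasurable hX.aestronglyMeasurable).sub
    aestronglyMeasurable_const) (Filter.Eventually.of_forall fun ω => ?_)
  rw [Real.norm_of_nonneg (sub_nonneg.2 (globalObj_wStar_le hN hlam hmu hf _))]
  exact globalObj_sub_wStar_le hN hlam hmu hf _

theorem localErr_theta (run : Run D ℓ T R S B lam beta eta nu w0 P) (t : ℕ) (i : Fin N) (ω : Ω) :
    localErr lam eta (expectedLoss D ℓ i) (fun k => run.theta t i k ω) (run.w t ω) R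
      = (1 / (R : ℝ)) * ∑ r ∈ Finset.range R,
        ‖run.theta t i r ω - prox lam (expectedLoss D ℓ i) (run.wLoc t i r ω)‖ ^ 2 := rfl

theorem integral_localErr_le (run : Run D ℓ T R S B lam beta eta nu w0 P) (hR : 0 < R)
    (hd : run.IsDeltaApprox delta) {t : ℕ} (ht : t < T) (i : Fin N) :
    Integrable (fun ω => localErr lam eta (expectedLoss D ℓ i) (fun k => run.theta t i k ω)
        (run.w t ω) R) P ∧
      ∫ ω, localErr lam eta (expectedLoss D ℓ i) (fun k => run.theta t i k ω) (run.w t ω) R ∂P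
        ≤ delta ^ 2 := by
  have hRr : (R : ℝ) ≠ 0 := by positivity
  have h1 : ∀ r ∈ Finset.range R, Integrable (fun ω =>
      ‖run.theta t i r ω - prox lam (expectedLoss D ℓ i) (run.wLoc t i r ω)‖ ^ 2) P :=
    fun r hr => (hd t i r (Or.inl ⟨ht, Finset.mem_range.1 hr⟩)).1
  simp only [localErr_theta]
  refine ⟨(integrable_finsetSum _ h1).const_mul _, ?_⟩
  rw [integral_const_mul, integral_finsetSum _ h1]
  calc _ ≤ (1 / (R : ℝ)) * ∑ _r ∈ Finset.range R, delta ^ 2 := by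
        refine mul_le_mul_of_nonneg_left (Finset.sum_le_sum fun r hr => ?_) (by positivity)
        exact (hd t i r (Or.inl ⟨ht, Finset.mem_range.1 hr⟩)).2
    _ = delta ^ 2 := by
        rw [Finset.sum_const, Finset.card_range, nsmul_eq_mul]
        field_simp

/-- One round of the algorithm in expectation. -/
theorem integral_round_le [IsProbabilityMeasure P]
    (run : Run D ℓ T R S B lam beta eta nu w0 P) (hR : 0 < R) (hS0 : 0 < S)
    (hS : S ≤ N) (hlam : 0 < lam) (hmu : 0 < mu) (hb : 1 ≤ beta)
    (hf : ∀ i, StronglyConvex mu (expectedLoss D ℓ i)) (heta : 0 < eta)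
    (htau : eta * beta * R ≤ etaHat lam mu beta) (hd : run.IsDeltaApprox delta) {t : ℕ}
    (ht : t < T) :
    let f := expectedLoss D ℓ
    let wS := wStar lam f
    let m := muF lam mu
    ∫ ω, ‖run.w (t + 1) ω - wS‖ ^ 2 ∂P
      ≤ (1 - eta * beta * R * m / 2) * ∫ ω, ‖run.w t ω - wS‖ ^ 2 ∂P
        - eta * beta * R / 2 * ∫ ω, (globalObj lam f (run.w t ω) - globalObj lam f wS) ∂P
        + ((eta * beta * R) ^ 2 * (12 * (((N : ℝ) / S - 1) / N) * sigmaSq lam f)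
          + (eta * beta * R) ^ 3 * (24 * (lam / m * lam / beta ^ 2) * sigmaSq lam f)
          + 7 * (eta * beta * R) / m * lam ^ 2 * delta ^ 2) := by
  intro f wS m
  have hN : 0 < N := hS0.trans_le hS
  have hm : 0 < m := muF_pos hlam hmu
  have hRr : (0 : ℝ) < R := by positivity
  have hb0 : 0 < beta := by linarith
  set h : Finset (Fin N) → Ω → ℝ := fun s ω =>
    ‖nextModel R S lam beta eta (fun i k => run.theta t i k ω) (run.w t ω) s - wS‖ ^ 2 with hh
  have hw := run.memLp_w hlam hmu hf hd ht.le
  have hwm := run.measurable_w ht.le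
  have hle : run.hist t 0 ≤ run.hist t R := run.hist_mono t (Nat.zero_le R)
  have hhm : ∀ s, Measurable[run.hist t R] (h s) := by
    intro s
    have h1 : Measurable[run.hist t R] fun ω =>
        nextModel R S lam beta eta (fun i k => run.theta t i k ω) (run.w t ω) s :=
      ((hwm.mono hle le_rfl).const_smul (1 - beta)).add (Measurable.const_smul
        (Finset.measurable_fun_sum s fun i _ => run.measurable_wLoc ht i le_rfl) (beta / (S : ℝ)))
    exact ((continuous_id.sub continuous_const).norm.pow 2).measurable.comp h1
  have hhi : ∀ s, Integrable (h s) P := by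
    intro s
    have h1 : MemLp (fun ω =>
        nextModel R S lam beta eta (fun i k => run.theta t i k ω) (run.w t ω) s) 2 P :=
      (hw.const_smul (1 - beta)).add ((memLp_finsetSum s fun i _ =>
        run.memLp_wLoc_of_w hlam hmu hf hd ht hw i le_rfl).const_smul (beta / (S : ℝ)))
    exact (h1.sub (memLp_const wS)).integrable_norm_pow (by norm_num)
  -- The candidate next models for all sets `s` are determined at the end of the local updates, so
  -- the sampled set can be averaged out first.
  have hstep : ∫ ω, ‖run.w (t + 1) ω - wS‖ ^ 2 ∂P = ∫ ω, subsetMean S (fun s => h s ω) ∂P :=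
    run.integral_sel hS ht hhm hhi
  rw [hstep]
  have i1 : Integrable (fun ω => ‖run.w t ω - wS‖ ^ 2) P :=
    (hw.sub (memLp_const wS)).integrable_norm_pow (by norm_num)
  have i2 := integrable_globalObj_sub hN hlam hmu hf hw
  have i3 := fun i => run.integral_localErr_le hR hd ht i
  have i4 : Integrable (fun ω => subsetMean S (fun s => h s ω)) P :=
    (integrable_finsetSum _ fun s _ => hhi s).const_mul _
  have i5 : Integrable (fun ω => (1 / (N : ℝ)) * ∑ i, localErr lam eta (f i)
      (fun k => run.theta t i k ω) (run.w t ω) R) P :=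
    (integrable_finsetSum _ fun i _ => (i3 i).1).const_mul _
  have hlocal : ∫ ω, (1 / (N : ℝ)) * ∑ i, localErr lam eta (f i)
      (fun k => run.theta t i k ω) (run.w t ω) R ∂P ≤ delta ^ 2 := by
    have hNr : (N : ℝ) ≠ 0 := by positivity
    rw [integral_const_mul, integral_finsetSum _ fun i _ => (i3 i).1]
    calc _ ≤ (1 / (N : ℝ)) * ∑ _i : Fin N, delta ^ 2 :=
          mul_le_mul_of_nonneg_left (Finset.sum_le_sum fun i _ => (i3 i).2) (by positivity)
      _ = delta ^ 2 := by simp; field_simp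
  have i6 := ((i1.const_mul (1 - eta * beta * R * m / 2)).sub
    (i2.const_mul (eta * beta * R / 2)))
  have hmono := integral_mono i4 ((i6.add (integrable_const
      ((eta * beta * R) ^ 2 * (12 * (((N : ℝ) / S - 1) / N) * sigmaSq lam f)
          + (eta * beta * R) ^ 3 * (24 * (lam / m * lam / beta ^ 2) * sigmaSq lam f)))).add
      (i5.const_mul (7 * (eta * beta * R) / m * lam ^ 2)))
    fun ω => subsetMean_round_le hR hS0 hS hlam hmu hb hf heta htau
      (fun i k => run.theta t i k ω) (run.w t ω)
  rw [integral_add' (i6.add (integrable_const _)) (i5.const_mul _),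
    integral_add' i6 (integrable_const _),
    integral_sub' (i1.const_mul _) (i2.const_mul _), integral_const_mul, integral_const_mul,
    integral_const_mul, integral_const, probReal_univ, one_smul] at hmono
  have := mul_le_mul_of_nonneg_left hlocal
    (show 0 ≤ 7 * (eta * beta * R) / m * lam ^ 2 by positivity)
  linarith

end Run

/-! ### Bounds for a whole run with a given step size. -/

namespace Run

variable {d N : ℕ} {Ξ : Fin N → Type*} [∀ i, MeasurableSpace (Ξ i)]
  {D : ∀ i, Measure (Ξ i)} {ℓ : ∀ i, Model d → Ξ i → ℝ} {T R S B : ℕ}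
  {lam mu beta eta nu delta : ℝ} {w0 : Model d} {Ω : Type*} [mΩ : MeasurableSpace Ω]
  {P : Measure Ω}

/-- The additive noise of one round. -/
def roundNoise (N S R : ℕ) (lam mu beta eta sig2 delta : ℝ) : ℝ :=
  (eta * beta * R) ^ 2 * (12 * (((N : ℝ) / S - 1) / N) * sig2)
    + (eta * beta * R) ^ 3 * (24 * (lam / muF lam mu * lam / beta ^ 2) * sig2)
    + 7 * (eta * beta * R) / muF lam mu * lam ^ 2 * delta ^ 2

/-- The bound for the weighted average of the global models. -/
def averageBound (N S R T : ℕ) (lam mu beta eta sig2 delta delta0 : ℝ) : ℝ :=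
  2 * muF lam mu * delta0 * Real.exp (-(eta * beta * R * muF lam mu * T) / 2)
    + 2 * roundNoise N S R lam mu beta eta sig2 delta / (eta * beta * R)

/-- The hypothesis `h` is the outcome of `exists_step_size`. In `averageBound` the exponential,
sampling, drift and accuracy terms have coefficients `2, 24, 48, 14`; bounding the first three by
`48` and using the `5` in `h` gives `240 = 48 * 5`. -/
theorem averageBound_le_errorBound (hR : 0 < R) (hS0 : 0 < S) (hS : S ≤ N) (hT0 : 0 < T)
    (hlam : 0 < lam) (hmu : 0 < mu) (hb : 1 ≤ beta) {sig2 delta0 : ℝ} (hsig : 0 ≤ sig2)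
    (heta : 0 < eta) (hd0 : 0 ≤ delta0)
    (h : muF lam mu * delta0 * Real.exp (-(eta * beta * R * muF lam mu * T) / 2)
        + eta * beta * R * muF lam mu * T * samplingErr N S T (muF lam mu) sig2
        + (eta * beta * R * muF lam mu * T) ^ 2 * driftErr R T lam beta (muF lam mu) sig2 delta
      ≤ delta0 * muF lam mu * Real.exp (-(etaHat lam mu beta * muF lam mu * T) / 2)
        + 3 * (logFactor (muF lam mu) delta0 (samplingErr N S T (muF lam mu) sig2
          + driftErr R T lam beta (muF lam mu) sig2 delta) * samplingErr N S T (muF lam mu) sig2)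
        + 5 * (logFactor (muF lam mu) delta0 (samplingErr N S T (muF lam mu) sig2
          + driftErr R T lam beta (muF lam mu) sig2 delta) ^ 2
            * driftErr R T lam beta (muF lam mu) sig2 delta)) :
    averageBound N S R T lam mu beta eta sig2 delta delta0
      ≤ 240 * errorBound N S R T lam mu beta sig2 delta delta0 := by
  have hm := muF_pos hlam hmu
  have hN : 0 < N := hS0.trans_le hS
  unfold averageBound roundNoise errorBound
  simp only
  set m := muF lam mu with hmdef
  have hRr : (0 : ℝ) < R := by positivity
  have hNr : (0 : ℝ) < N := by positivity
  have hSr : (0 : ℝ) < S := by positivity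
  have hTr : (0 : ℝ) < T := by positivity
  have hb0 : 0 < beta := by linarith
  set tau := eta * beta * R with htau
  have ht0 : 0 < tau := by positivity
  have hNS : 0 ≤ (N : ℝ) / S - 1 := by
    rw [sub_nonneg, one_le_div hSr]
    exact_mod_cast hS
  have hn1 : tau * m * T * samplingErr N S T m sig2 = tau * (((N : ℝ) / S - 1) / N) * sig2 := by
    unfold samplingErr; field_simp
  -- Only an inequality: the `δ² lam²` part of `driftErr` is slack here.
  have hn2 : tau ^ 2 * (lam / m * lam / beta ^ 2) * sig2
      ≤ (tau * m * T) ^ 2 * driftErr R T lam beta m sig2 delta := by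
    have e : (tau * m * T) ^ 2 * driftErr R T lam beta m sig2 delta
        = tau ^ 2 * (lam / m * lam / beta ^ 2) * sig2
          + tau ^ 2 * (lam / m * lam / beta ^ 2) * (delta ^ 2 * lam ^ 2 / R) := by
      unfold driftErr; field_simp
    rw [e]
    exact le_add_of_nonneg_right (by positivity)
  have hsamp : 0 ≤ samplingErr N S T m sig2 := by unfold samplingErr; positivity
  have hdrift : 0 ≤ driftErr R T lam beta m sig2 delta := by unfold driftErr; positivity
  have hlog : 0 ≤ logFactor m delta0 (samplingErr N S T m sig2
      + driftErr R T lam beta m sig2 delta) := by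
    unfold logFactor
    have := le_max_left 0 (Real.log (m * delta0 / (samplingErr N S T m sig2
      + driftErr R T lam beta m sig2 delta)))
    linarith
  have hsplit : 2 * (tau ^ 2 * (12 * (((N : ℝ) / S - 1) / N) * sig2)
      + tau ^ 3 * (24 * (lam / m * lam / beta ^ 2) * sig2)
      + 7 * tau / m * lam ^ 2 * delta ^ 2) / tau
      = 24 * (tau * (((N : ℝ) / S - 1) / N) * sig2)
        + 48 * (tau ^ 2 * (lam / m * lam / beta ^ 2) * sig2) + 14 * (lam ^ 2 * delta ^ 2 / m) := by
    field_simp; ring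
  rw [hsplit, ← hn1]
  generalize samplingErr N S T m sig2 = n1 at *
  generalize driftErr R T lam beta m sig2 delta = n2 at *
  generalize logFactor m delta0 (n1 + n2) = L at *
  have p1 : 0 ≤ L * n1 := by positivity
  have p2 : 0 ≤ L ^ 2 * n2 := by positivity
  have p3 : 0 ≤ m * delta0 * Real.exp (-(tau * m * T) / 2) := by positivity
  have p4 : 0 ≤ tau * m * T * n1 := by positivity
  have p5 : 0 ≤ (tau * m * T) ^ 2 * n2 := by positivity
  have p6 : 0 ≤ lam ^ 2 * delta ^ 2 / m := by positivity
  have p7 : 0 ≤ delta0 * m * Real.exp (-(etaHat lam mu beta * m * T) / 2) := by positivity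
  linarith

/-- The personalized models computed at the final global model. -/
theorem integral_theta_final_le [IsProbabilityMeasure P]
    (run : Run D ℓ T R S B lam beta eta nu w0 P) (hN : 0 < N) (hlam : 0 < lam) (hmu : 0 < mu)
    (hf : ∀ i, StronglyConvex mu (expectedLoss D ℓ i)) (hd : run.IsDeltaApprox delta) :
    let f := expectedLoss D ℓ
    let wS := wStar lam f
    (∀ i, Integrable (fun ω => ‖run.theta T i 0 ω - wS‖ ^ 2) P) ∧
      (1 / (N : ℝ)) * ∑ i, ∫ ω, ‖run.theta T i 0 ω - wS‖ ^ 2 ∂P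
        ≤ 9 * ∫ ω, ‖run.w T ω - wS‖ ^ 2 ∂P + 6 * (sigmaSq lam f / lam ^ 2) + 3 * delta ^ 2 := by
  intro f wS
  have hact : Active T R T 0 := Or.inr ⟨rfl, rfl⟩
  have hw := run.memLp_w hlam hmu hf hd le_rfl
  have i1 : Integrable (fun ω => ‖run.w T ω - wS‖ ^ 2) P :=
    (hw.sub (memLp_const wS)).integrable_norm_pow (by norm_num)
  have hth : ∀ i, Measurable (run.theta T i 0) := fun i =>
    (run.theta_measurable T i 0 hact).mono (run.hist_le _ _) le_rfl
  have hpt : ∀ i ω, ‖run.theta T i 0 ω - wS‖ ^ 2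
      ≤ 3 * ‖run.theta T i 0 ω - prox lam (f i) (run.wLoc T i 0 ω)‖ ^ 2
        + 9 * ‖run.w T ω - wS‖ ^ 2 + 6 * (‖moreauGrad lam (f i) wS‖ ^ 2 / lam ^ 2) := by
    intro i ω
    have e0 : run.wLoc T i 0 ω = run.w T ω := rfl
    rw [e0]
    -- Inaccuracy, then the proximal displacement, then the distance to `w*`. The displacement is
    -- `‖∇F_i(w_T)‖ / lam ≤ ‖w_T - w*‖ + ‖∇F_i(w*)‖ / lam`, whence `9 = 3 + 3 * 2` and `6 = 3 * 2`.
    have e1 : run.theta T i 0 ω - wS = (run.theta T i 0 ω - prox lam (f i) (run.w T ω))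
        + (prox lam (f i) (run.w T ω) - run.w T ω) + (run.w T ω - wS) := by abel
    have h1 := norm_add_three_sq_le (run.theta T i 0 ω - prox lam (f i) (run.w T ω))
      (prox lam (f i) (run.w T ω) - run.w T ω) (run.w T ω - wS)
    rw [← e1] at h1
    have h2 : ‖moreauGrad lam (f i) (run.w T ω)‖
        = lam * ‖prox lam (f i) (run.w T ω) - run.w T ω‖ := by
      rw [moreauGrad, norm_smul, Real.norm_of_nonneg hlam.le, norm_sub_rev]
    have h3 := norm_moreauGrad_sub_le hlam hmu (hf i) (run.w T ω) wS
    have h4 : ‖moreauGrad lam (f i) (run.w T ω)‖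
        ≤ lam * ‖run.w T ω - wS‖ + ‖moreauGrad lam (f i) wS‖ := by
      have := norm_add_le (moreauGrad lam (f i) (run.w T ω) - moreauGrad lam (f i) wS)
        (moreauGrad lam (f i) wS)
      rw [sub_add_cancel] at this
      exact this.trans (add_le_add_left h3 _)
    rw [h2] at h4
    have h5 : ‖prox lam (f i) (run.w T ω) - run.w T ω‖
        ≤ ‖run.w T ω - wS‖ + ‖moreauGrad lam (f i) wS‖ / lam := by
      rw [← mul_le_mul_iff_right₀ hlam, mul_add, mul_div_cancel₀ _ hlam.ne']
      exact h4
    have h6 := pow_le_pow_left₀ (norm_nonneg _) h5 2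
    rw [← div_pow]
    nlinarith [sq_nonneg (‖run.w T ω - wS‖ - ‖moreauGrad lam (f i) wS‖ / lam)]
  have hint : ∀ i, Integrable (fun ω =>
      3 * ‖run.theta T i 0 ω - prox lam (f i) (run.wLoc T i 0 ω)‖ ^ 2
        + 9 * ‖run.w T ω - wS‖ ^ 2) P := fun i =>
    ((hd T i 0 hact).1.const_mul 3).add (i1.const_mul 9)
  have hle : ∀ i, ∫ ω, ‖run.theta T i 0 ω - wS‖ ^ 2 ∂P
      ≤ 3 * delta ^ 2 + 9 * ∫ ω, ‖run.w T ω - wS‖ ^ 2 ∂P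
        + 6 * (‖moreauGrad lam (f i) wS‖ ^ 2 / lam ^ 2) := by
    intro i
    refine (integral_mono_of_nonneg (Filter.Eventually.of_forall fun ω => by positivity)
      ((hint i).add (integrable_const _)) (Filter.Eventually.of_forall (hpt i))).trans ?_
    rw [integral_add' (hint i) (integrable_const _),
      integral_add ((hd T i 0 hact).1.const_mul 3) (i1.const_mul 9), integral_const_mul,
      integral_const_mul, integral_const, probReal_univ, one_smul]
    have := (hd T i 0 hact).2
    linarith
  refine ⟨fun i => ?_, ?_⟩
  · refine ((hint i).add (integrable_const (6 * (‖moreauGrad lam (f i) wS‖ ^ 2 / lam ^ 2)))).mono'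
      (((hth i).sub_const wS).norm.pow_const 2).aestronglyMeasurable
      (Filter.Eventually.of_forall fun ω => ?_)
    rw [Real.norm_of_nonneg (by positivity)]
    exact hpt i ω
  · have hNr : (N : ℝ) ≠ 0 := by positivity
    refine (mul_le_mul_of_nonneg_left (Finset.sum_le_sum fun i _ => hle i)
      (by positivity)).trans (le_of_eq ?_)
    rw [sigmaSq_eq hlam hmu hf, Finset.sum_add_distrib, ← Finset.mul_sum, ← Finset.sum_div]
    simp only [Finset.sum_const, Finset.card_univ, Fintype.card_fin, nsmul_eq_mul]
    field_simp
    ring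

/-- Convergence of a run with a given step size. -/
theorem convergence [IsProbabilityMeasure P] (run : Run D ℓ T R S B lam beta eta nu w0 P)
    (hR : 0 < R) (hS0 : 0 < S) (hS : S ≤ N) (hlam : 0 < lam) (hmu : 0 < mu) (hb : 1 ≤ beta)
    (hf : ∀ i, StronglyConvex mu (expectedLoss D ℓ i)) (heta : 0 < eta)
    (htau : eta * beta * R ≤ etaHat lam mu beta) (hT : 2 ≤ eta * beta * R * muF lam mu * T)
    (hd : run.IsDeltaApprox delta) :
    let f := expectedLoss D ℓ
    let wS := wStar lam f
    let m := muF lam mu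
    let b := averageBound N S R T lam mu beta eta (sigmaSq lam f) delta (‖w0 - wS‖ ^ 2)
    (Integrable (fun ω => globalObj lam f (run.wBar m ω) - globalObj lam f wS) P ∧
      ∫ ω, (globalObj lam f (run.wBar m ω) - globalObj lam f wS) ∂P ≤ b) ∧
    ∫ ω, ‖run.w T ω - wS‖ ^ 2 ∂P ≤ 1 / m * b := by
  intro f wS m b
  have hN : 0 < N := hS0.trans_le hS
  have hm : 0 < m := muF_pos hlam hmu
  have hRr : (0 : ℝ) < R := by positivity
  have hb0 : 0 < beta := by linarith
  have ht0 : 0 < eta * beta * R := by positivity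
  have htm : eta * beta * R * m ≤ 1 := by
    have h1 := (step_bounds hlam hmu hb htau ht0.le).1
    have h2 : eta * beta * R * m ≤ eta * beta * R * lam :=
      mul_le_mul_of_nonneg_left (muF_le hlam hmu) ht0.le
    have h3 : 0 ≤ eta * beta * R * lam := by positivity
    linarith
  have hgap : ∀ x, 0 ≤ globalObj lam f x - globalObj lam f wS := fun x =>
    sub_nonneg.2 (globalObj_wStar_le hN hlam hmu hf x)
  obtain ⟨hA, havg, hlast⟩ := weighted_bounds
    (c := roundNoise N S R lam mu beta eta (sigmaSq lam f) delta) hm ht0 htm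
    (a := fun t => ∫ ω, ‖run.w t ω - wS‖ ^ 2 ∂P)
    (Φ := fun t => ∫ ω, (globalObj lam f (run.w t ω) - globalObj lam f wS) ∂P) hT
    (fun t => integral_nonneg fun ω => by positivity) (fun t => integral_nonneg fun ω => hgap _)
    fun t ht => run.integral_round_le hR hS0 hS hlam hmu hb hf heta htau hd ht
  have ha0 : ∫ ω, ‖run.w 0 ω - wS‖ ^ 2 ∂P = ‖w0 - wS‖ ^ 2 := by
    simp only [w_zero, integral_const, probReal_univ, one_smul]
  simp only [ha0] at havg hlast
  refine ⟨?_, hlast⟩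
  have hwt : ∀ t ∈ Finset.range T, MemLp (run.w t) 2 P := fun t ht =>
    run.memLp_w hlam hmu hf hd (Finset.mem_range.1 ht).le
  have hbar : MemLp (run.wBar m) 2 P :=
    (memLp_finsetSum _ fun t ht => (hwt t ht).const_smul (weight R beta eta m t)).const_smul
      (∑ t ∈ Finset.range T, weight R beta eta m t)⁻¹
  have hint := integrable_globalObj_sub hN hlam hmu hf hbar
  refine ⟨hint, le_trans ?_ havg⟩
  have hti : ∀ t ∈ Finset.range T, Integrable (fun ω => weight R beta eta m t *
      (globalObj lam f (run.w t ω) - globalObj lam f wS)) P := fun t ht =>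
    (integrable_globalObj_sub hN hlam hmu hf (hwt t ht)).const_mul _
  have hrho : 0 < 1 - eta * beta * R * m / 2 := by linarith
  -- Jensen's inequality is applied for each `ω`, the weights being deterministic.
  refine (integral_mono hint ((integrable_finsetSum _ hti).const_mul
    (∑ t ∈ Finset.range T, weight R beta eta m t)⁻¹) fun ω =>
      globalObj_weighted_mean_le hN hlam hmu hf (Finset.range T)
        (fun t _ => by positivity) hA (fun t => run.w t ω) _).trans (le_of_eq ?_)
  rw [integral_const_mul, integral_finsetSum _ hti]
  simp only [integral_const_mul]
  rfl

end Run

end PFedMe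

end

/-! ### Assembly of the theorem. -/

theorem theorem1 :
    ∃ C : ℝ, 0 < C ∧
      ∀ (d N T R S B : ℕ) (lam mu beta gam nu delta : ℝ) (w0 : PFedMe.Model d)
        (Ξ : Fin N → Type*) [∀ i, MeasurableSpace (Ξ i)]
        (D : ∀ i, Measure (Ξ i)) [∀ i, IsProbabilityMeasure (D i)]
        (ℓ : ∀ i, PFedMe.Model d → Ξ i → ℝ),
        0 < R → 0 < S → S ≤ N → 0 < B → 0 < lam → 0 < mu → 1 ≤ beta → 0 ≤ delta →
        PFedMe.IsStochasticLoss D ℓ →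
        (∀ i, PFedMe.StronglyConvex mu (PFedMe.expectedLoss D ℓ i)) →
        PFedMe.BoundedVariance D ℓ gam →
        2 / (PFedMe.etaHat lam mu beta * PFedMe.muF lam mu) ≤ (T : ℝ) →
        ∃ eta : ℝ, 0 < eta ∧ eta ≤ PFedMe.etaHat lam mu beta / (beta * R) ∧
          ∀ (Ω : Type*) [MeasurableSpace Ω] (P : Measure Ω) [IsProbabilityMeasure P]
            (run : PFedMe.Run D ℓ T R S B lam beta eta nu w0 P),
            (run.IsDeltaApprox delta ∨
              ∃ m : ℝ, 0 < m ∧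
                (∀ (i : Fin N) (w : PFedMe.Model d) (batch : Fin B → Ξ i),
                  PFedMe.StronglyConvex m (PFedMe.batchObj ℓ lam i w batch)) ∧
                2 / m ^ 2 * (gam ^ 2 / B + nu) ≤ delta ^ 2) →
            let f := PFedMe.expectedLoss D ℓ
            let wS := PFedMe.wStar lam f
            let m := PFedMe.muF lam mu
            let sig2 := PFedMe.sigmaSq lam f
            let bound :=
              C * PFedMe.errorBound N S R T lam mu beta sig2 delta (‖w0 - wS‖ ^ 2)
            (Integrable
                (fun ω => PFedMe.globalObj lam f (run.wBar m ω) - PFedMe.globalObj lam f wS) P ∧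
              ∫ ω, (PFedMe.globalObj lam f (run.wBar m ω) - PFedMe.globalObj lam f wS) ∂P
                ≤ bound) ∧
            ((∀ i, Integrable (fun ω => ‖run.theta T i 0 ω - wS‖ ^ 2) P) ∧
              (1 / (N : ℝ)) * ∑ i, ∫ ω, ‖run.theta T i 0 ω - wS‖ ^ 2 ∂P
                ≤ 1 / m * bound + C * (sig2 / lam ^ 2 + delta ^ 2)) := by
  -- `2160 = 9 * 240`: the `240` of `averageBound_le_errorBound` times the factor `9` of the last
  -- distance in `integral_theta_final_le`.
  refine ⟨2160, by norm_num, ?_⟩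
  intro d N T R S B lam mu beta gam nu delta w0 Ξ _ D _ ℓ hR hS0 hS hB hlam hmu hb hdelta hloss hf
    hvar hT
  have hm := PFedMe.muF_pos hlam hmu
  have hh := PFedMe.etaHat_pos hlam hmu hb
  have hb0 : 0 < beta := by linarith
  have hRr : (0 : ℝ) < R := by positivity
  have hTr : (0 : ℝ) < T := lt_of_lt_of_le (by positivity) hT
  have hT0 : 0 < T := by exact_mod_cast hTr
  have hsig := PFedMe.sigmaSq_nonneg lam (PFedMe.expectedLoss D ℓ)
  have hNS : 0 ≤ (N : ℝ) / S - 1 := by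
    have hSr : (0 : ℝ) < S := by positivity
    rw [sub_nonneg, one_le_div hSr]
    exact_mod_cast hS
  obtain ⟨tau, ht0, hth, hT2, hbound⟩ := PFedMe.exists_step_size hm hh hT
    (sq_nonneg ‖w0 - PFedMe.wStar lam (PFedMe.expectedLoss D ℓ)‖)
    (n1 := PFedMe.samplingErr N S T (PFedMe.muF lam mu)
      (PFedMe.sigmaSq lam (PFedMe.expectedLoss D ℓ)))
    (n2 := PFedMe.driftErr R T lam beta (PFedMe.muF lam mu)
      (PFedMe.sigmaSq lam (PFedMe.expectedLoss D ℓ)) delta)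
    (by unfold PFedMe.samplingErr; positivity) (by unfold PFedMe.driftErr; positivity)
  have htau : tau / (beta * R) * beta * R = tau := by field_simp
  -- The step size is fixed here, before the probability space and the run are introduced.
  refine ⟨tau / (beta * R), by positivity, by gcongr, ?_⟩
  intro Ω _ P _ run hacc f wS m sig2 bound
  have hd : run.IsDeltaApprox delta := by
    rcases hacc with h | ⟨k, hk, hbatch, hk2⟩
    · exact h
    · exact run.isDeltaApprox_of_stronglyConvex hloss hlam hmu hB hf hvar hk hbatch hk2
  rw [← htau] at hth hT2 hbound
  have heta : 0 < tau / (beta * R) := by positivity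
  have herr := PFedMe.Run.averageBound_le_errorBound hR hS0 hS hT0 hlam hmu hb hsig heta
    (sq_nonneg ‖w0 - wS‖) hbound
  obtain ⟨⟨hint, hF⟩, hlast⟩ := run.convergence hR hS0 hS hlam hmu hb hf heta hth hT2 hd
  obtain ⟨hthint, hthle⟩ := run.integral_theta_final_le (hS0.trans_le hS) hlam hmu hf hd
  set E := PFedMe.errorBound N S R T lam mu beta sig2 delta (‖w0 - wS‖ ^ 2) with hE
  have hgap := integral_nonneg (μ := P) fun ω => sub_nonneg.2
    (PFedMe.globalObj_wStar_le (hS0.trans_le hS) hlam hmu hf (run.wBar m ω))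
  -- Nonnegativity comes from (a) itself, since `0 ≤ 𝔼[F - F*] ≤ 240 E`; it allows `240` to be
  -- enlarged to `2160`.
  have hE0 : 0 ≤ E := by
    have := hgap.trans (hF.trans herr)
    linarith
  refine ⟨⟨hint, hF.trans (herr.trans ?_)⟩, hthint, hthle.trans ?_⟩
  · simp only [bound]
    linarith
  · have h1 : 1 / m * PFedMe.Run.averageBound N S R T lam mu beta (tau / (beta * R)) sig2 delta
        (‖w0 - wS‖ ^ 2) ≤ 1 / m * (240 * E) :=
      mul_le_mul_of_nonneg_left herr (by have : 0 < m := hm; positivity)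
    have h2 : 1 / m * bound = 9 * (1 / m * (240 * E)) := by simp only [bound]; ring
    have h3 : 0 ≤ sig2 / lam ^ 2 := div_nonneg hsig (by positivity)
    have h4 := hlast.trans h1
    rw [h2]
    nlinarith [sq_nonneg delta]
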